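/- A \emph{geodesic space} is a metric space $(X,d)$ in which any two points $x,y$ are joined by a geodesic, i.e. an isometric embedding $\xi:[0,d(x,y)]\to X$ with $\xi(0)=x$ and $\xi(d(x,y))=y$. A subset of $X$ is \emph{convex} if it contains every geodesic of $X$ joining two of its points. A \emph{reflection} of $X$ is an isometry $r$ of $X$ such that $r^2=\mathrm{id}_X$, the fixed-point set $F_r$ (the \emph{wall} of $r$) has empty interior, and $X\setminus F_r$ has exactly two connected components, both of which are convex. Let $\Gamma$ be a group of isometries of a geodesic space $X$, and let $R$ be the set of all reflections of $X$ that belong to $\Gamma$. A \emph{chamber} is a connected component of $X\setminus\bigcup_{r\in R}F_r$. The group $\Gamma$ is a \emph{cocompact discrete reflection group} of $X$ if 1. $\Gamma$ is generated by some set of reflections of $X$; 2. the action of $\Gamma$ on $X$ is proper, that is, $\{\gamma\in\Gamma : \gamma x\in B(x,N)\}$ is finite for all $x\in X$ and $N>0$; 3. for some chamber $C$, the closure $\overline{C}$ is compact and $\{\gamma\in\Gamma : C=\gamma C\}=\{1\}$. An abstract group is called a cocompact discrete reflection group of $X$ if it is isomorphic to such a group of isometries. A \emph{Coxeter group} is a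 group having a presentation $\langle S \mid (st)^{m(s,t)}=1 \text{ for } s,t\in S\rangle$, where $S$ is a finite set and $m:S\times S\to\mathbb{N}\cup\{\infty\}$ satisfies $m(s,t)=m(t,s)$, $m(s,s)=1$, and $m(s,t)\ge 2$ for $s\ne t$ (no relation is imposed when $m(s,t)=\infty$). **Theorem.** A group $\Gamma$ is a cocompact discrete reflection group of some geodesic space if and only if $\Gamma$ is a Coxeter group. -/

import Mathlib

universe u v

/-- `ξ`, restricted to `[0, d(x,y)]`, is a geodesic from `x` to `y`: an isometric embedding of
`[0, d(x,y)]` with `ξ 0 = x` and `ξ (d(x,y)) = y`. Values outside `[0, d(x,y)]` are irrelevant. -/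
def IsGeodesic {X : Type v} [MetricSpace X] (ξ : ℝ → X) (x y : X) : Prop :=
  (∀ s ∈ Set.Icc 0 (dist x y), ∀ t ∈ Set.Icc 0 (dist x y), dist (ξ s) (ξ t) = |s - t|) ∧
    ξ 0 = x ∧ ξ (dist x y) = y

/-- A geodesic space: any two points are joined by a geodesic. -/
def IsGeodesicSpace (X : Type v) [MetricSpace X] : Prop :=
  ∀ x y : X, ∃ ξ : ℝ → X, IsGeodesic ξ x y

/-- A subset is convex if every geodesic joining two of its points is contained in it. -/
def IsGeodesicallyConvex {X : Type v} [MetricSpace X] (A : Set X) : Prop :=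
  ∀ x ∈ A, ∀ y ∈ A, ∀ ξ : ℝ → X, IsGeodesic ξ x y → ∀ t ∈ Set.Icc 0 (dist x y), ξ t ∈ A

/-- The set of connected components of a subset `U`. -/
def connectedComponentsOf {X : Type v} [MetricSpace X] (U : Set X) : Set (Set X) :=
  {C | ∃ x ∈ U, C = connectedComponentIn U x}

/-- The fixed-point set of an isometry `r` (the wall of `r`, when `r` is a reflection). -/
def wall {X : Type v} [MetricSpace X] (r : X ≃ᵢ X) : Set X :=
  {x | r x = x}

/-- A reflection: an isometry with `r² = id` whose fixed-point set has empty interior and whose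
complement of the fixed-point set has exactly two connected components, both convex. -/
def IsReflection {X : Type v} [MetricSpace X] (r : X ≃ᵢ X) : Prop :=
  (∀ x, r (r x) = x) ∧
    (connectedComponentsOf (wall r)ᶜ).ncard = 2 ∧
    (∀ A ∈ connectedComponentsOf (wall r)ᶜ, IsGeodesicallyConvex A) ∧
    interior (wall r) = ∅

/-- A group of isometries of `X` is a reflection group if some set of reflections generates it. -/
def IsReflectionGroup {X : Type v} [MetricSpace X] (G : Subgroup (X ≃ᵢ X)) : Prop :=
  ∃ T : Set (X ≃ᵢ X), (∀ r ∈ T, IsReflection r) ∧ Subgroup.closure T = G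

/-- The action of `G` is proper: for every point `x` and every `N > 0` only finitely many
elements of `G` move `x` to a point of the ball `B(x, N)`. -/
def IsProperIsometryGroup {X : Type v} [MetricSpace X] (G : Subgroup (X ≃ᵢ X)) : Prop :=
  ∀ (x : X) (N : ℝ), 0 < N → {g : X ≃ᵢ X | g ∈ G ∧ g x ∈ Metric.ball x N}.Finite

/-- A chamber of `G`: a connected component of the complement of the union of the walls of all
reflections of `X` that belong to `G`. -/
def IsChamber {X : Type v} [MetricSpace X] (G : Subgroup (X ≃ᵢ X)) (C : Set X) : Prop :=
  C ∈ connectedComponentsOf (⋃ r ∈ {r : X ≃ᵢ X | r ∈ G ∧ IsReflection r}, wall r)ᶜ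

/-- A cocompact discrete reflection group: a reflection group acting properly, with a chamber
whose closure is compact and whose stabilizer is trivial. -/
def IsCocompactDiscreteReflectionGroup {X : Type v} [MetricSpace X]
    (G : Subgroup (X ≃ᵢ X)) : Prop :=
  IsReflectionGroup G ∧ IsProperIsometryGroup G ∧
    ∃ C : Set X, IsChamber G C ∧ IsCompact (closure C) ∧ {g : X ≃ᵢ X | g ∈ G ∧ C = g '' C} = {1}

/-- A Coxeter group: a group having a Coxeter presentation with a finite set of generators. In a
`CoxeterMatrix` the entry `0` encodes `∞`, that is, the absence of a relation. -/
def IsFiniteRankCoxeterGroup (Γ : Type u) [Group Γ] : Prop :=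
  ∃ (B : Type) (_ : Finite B) (M : CoxeterMatrix B), Nonempty (CoxeterSystem M Γ)

/-! Both directions rest on counting walls. Let `G` be a cocompact discrete reflection group and `x`
a point off all its walls. Attach to `g` the set `N g` of reflections in `G` whose walls separate
`x` from `g x`. It is finite by properness, because a separating wall meets a geodesic from `x` to
`g x`. Since a wall has exactly two sides, `N (g * h)` is the symmetric difference of `N g` and the
conjugate of `N h` by `g`. Call `s` simple if `N s = {s}`. For `g ≠ 1` triviality of the chamber
stabilizer makes `N g` nonempty, and looking at the first wall point on a geodesic shows that `N g`
contains a simple reflection (`exists_simple_mem_separating`).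

Such a cocycle alone forces a Coxeter presentation: the cardinality of `N g` is the word length, the
exchange condition follows, and Matsumoto's argument (`prod_eq_of_reduced`) shows that the dihedral
relations suffice. Compactness of the closed chamber bounds how far simple reflections move `x`, so
there are finitely many of them.

Conversely, a Coxeter group acts on the realization of its Cayley graph. A Coxeter reflection
exchanges the ends of every edge that joins its two sides (`conj_eq_simple_of_crossing`). Its wall
therefore consists of edge midpoints, and its sides are convex: a path between two points of one
side that touches such a midpoint can be shortened through the near end of the edge. Every edge
midpoint lies on a wall and no vertex does, so the chamber of the identity vertex lies in the ball
of radius 1/2 around it. This gives compactness and trivial stabilizer. -/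

/-! ### Groups with an inversion cocycle are Coxeter groups -/

/-- A group generated by involutions `σ i` together with a finite-set valued inversion cocycle. -/
structure InversionCocycle {G : Type*} [Group G] {B : Type*} (σ : B → G) (N : G → Set G) :
    Prop where
  injective : Function.Injective σ
  mul_self : ∀ i, σ i * σ i = 1
  finite : ∀ g, (N g).Finite
  mem_mul : ∀ g h r, r ∈ N (g * h) ↔ Xor (r ∈ N g) (g⁻¹ * r * g ∈ N h)
  simple : ∀ i, N (σ i) = {σ i}
  exists_mem : ∀ g, g ≠ 1 → ∃ i, σ i ∈ N g

/-- The word of length `n` alternating between `i` and `j`, with first letter `i`. -/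
def altWord {B : Type*} : ℕ → B → B → List B
  | 0, _, _ => []
  | n + 1, i, j => i :: altWord n j i

/-- Two alternating words of the same length `n` with different first letters agree in a group
exactly when `(τ i * τ j) ^ n = 1`; this is how braid relations and Coxeter relations are exchanged
below. -/
theorem prod_altWord {G : Type*} [Group G] {B : Type*} (τ : B → G) (hτ : ∀ i, τ i * τ i = 1)
    (n : ℕ) (i j : B) :
    ((altWord n i j).map τ).prod = (τ i * τ j) ^ n * ((altWord n j i).map τ).prod := by
  have hinv : ∀ i, (τ i)⁻¹ = τ i := fun i => inv_eq_of_mul_eq_one_left (hτ i)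
  induction n generalizing i j with
  | zero => simp [altWord]
  | succ n ih =>
    have h1 : τ j * (τ i * τ j) ^ n = ((τ i * τ j) ^ n)⁻¹ * τ j := by
      have h2 : SemiconjBy (τ j) (τ i * τ j) (τ j * τ i) := by simp [SemiconjBy, mul_assoc]
      have := (h2.pow_right n).eq
      rw [this, ← inv_pow]
      simp [hinv]
    simp only [altWord, List.map_cons, List.prod_cons]
    rw [ih i j, ← mul_assoc (τ j), h1, pow_succ']
    rw [show τ i * τ j * (τ i * τ j) ^ n * (((τ i * τ j) ^ n)⁻¹ * τ j *
      (List.map τ (altWord n j i)).prod) = τ i * (τ j * τ j) * (List.map τ (altWord n j i)).prod by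
        group]
    rw [hτ, mul_one]

namespace InversionCocycle

variable {G : Type*} [Group G] {B : Type*} {σ : B → G} {N : G → Set G}

theorem inv_simple (h : InversionCocycle σ N) (i : B) : (σ i)⁻¹ = σ i :=
  inv_eq_of_mul_eq_one_left (h.mul_self i)

theorem map_one (h : InversionCocycle σ N) : N 1 = ∅ := by
  ext r
  have := h.mem_mul 1 1 r
  simpa [Xor] using this

theorem mem_simple_mul (h : InversionCocycle σ N) (i : B) (g r : G) :
    r ∈ N (σ i * g) ↔ Xor (r = σ i) (σ i * r * σ i ∈ N g) := by
  rw [h.mem_mul, h.simple, h.inv_simple, Set.mem_singleton_iff]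

theorem simple_mem_simple_mul (h : InversionCocycle σ N) (i : B) (g : G) :
    σ i ∈ N (σ i * g) ↔ σ i ∉ N g := by
  rw [h.mem_simple_mul, h.mul_self, one_mul]
  simp [Xor]

/-- By the cocycle law the new set is the conjugate of `N g` by `σ i`, together with `σ i`. -/
theorem ncard_simple_mul_of_notMem (h : InversionCocycle σ N) (i : B) (g : G) (hi : σ i ∉ N g) :
    (N (σ i * g)).ncard = (N g).ncard + 1 := by
  have : N (σ i * g) = insert (σ i) ((fun r => σ i * r * σ i) '' N g) := by
    ext r
    rw [h.mem_simple_mul, Set.mem_insert_iff, Set.mem_image]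
    have key : σ i * r * σ i ∈ N g ↔ ∃ x ∈ N g, σ i * x * σ i = r := by
      constructor
      · intro hr
        refine ⟨_, hr, ?_⟩
        rw [show σ i * (σ i * r * σ i) * σ i = (σ i * σ i) * r * (σ i * σ i) by group, h.mul_self]
        simp
      · rintro ⟨x, hx, rfl⟩
        rw [show σ i * (σ i * x * σ i) * σ i = (σ i * σ i) * x * (σ i * σ i) by group, h.mul_self]
        simpa using hx
    rw [← key]
    have h2 : r = σ i → ¬ (σ i * r * σ i ∈ N g) := by
      rintro rfl
      rwa [h.mul_self, one_mul]
    unfold Xor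
    tauto
  rw [this, Set.ncard_insert_of_notMem _ ((h.finite g).image _), Set.ncard_image_of_injective]
  · intro a b hab
    simpa using hab
  · rintro ⟨x, hx, hxi⟩
    apply hi
    have : x = σ i := by
      have h3 : σ i * x = 1 := by simpa using hxi
      rw [← h.inv_simple]; exact eq_inv_of_mul_eq_one_right h3
    rwa [this] at hx

theorem ncard_simple_mul_of_mem (h : InversionCocycle σ N) (i : B) (g : G) (hi : σ i ∈ N g) :
    (N (σ i * g)).ncard + 1 = (N g).ncard := by
  have h1 : σ i ∉ N (σ i * g) := by rw [h.simple_mem_simple_mul]; simpa using hi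
  have := h.ncard_simple_mul_of_notMem i _ h1
  rw [← mul_assoc, h.mul_self, one_mul] at this
  exact this.symm

theorem ncard_prod_le (h : InversionCocycle σ N) (ω : List B) :
    (N (ω.map σ).prod).ncard ≤ ω.length := by
  induction ω with
  | nil => simp [h.map_one]
  | cons i ω ih =>
    rw [List.map_cons, List.prod_cons, List.length_cons]
    by_cases hi : σ i ∈ N (ω.map σ).prod
    · have := h.ncard_simple_mul_of_mem i _ hi; omega
    · have := h.ncard_simple_mul_of_notMem i _ hi; omega

/-- A word is reduced if its length is the number of inversions of its product. -/
def Reduced (σ : B → G) (N : G → Set G) (ω : List B) : Prop :=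
  (N (ω.map σ).prod).ncard = ω.length

theorem Reduced.tail (h : InversionCocycle σ N) {i : B} {ω : List B}
    (hω : Reduced σ N (i :: ω)) : Reduced σ N ω ∧ σ i ∉ N (ω.map σ).prod := by
  have h1 := h.ncard_prod_le ω
  unfold Reduced at *
  rw [List.map_cons, List.prod_cons, List.length_cons] at hω
  by_cases hi : σ i ∈ N (ω.map σ).prod
  · have := h.ncard_simple_mul_of_mem i _ hi; omega
  · have := h.ncard_simple_mul_of_notMem i _ hi
    exact ⟨by omega, hi⟩

theorem reduced_cons (h : InversionCocycle σ N) {i : B} {ω : List B} (hω : Reduced σ N ω)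
    (hi : σ i ∉ N (ω.map σ).prod) : Reduced σ N (i :: ω) := by
  have := h.ncard_simple_mul_of_notMem i _ hi
  unfold Reduced at *
  rw [List.map_cons, List.prod_cons, List.length_cons]
  omega

theorem head_mem (h : InversionCocycle σ N) {i : B} {ω : List B} (hω : Reduced σ N (i :: ω)) :
    σ i ∈ N ((i :: ω).map σ).prod := by
  rw [List.map_cons, List.prod_cons, h.simple_mem_simple_mul]
  exact (hω.tail h).2

/-- Peel off the first letter: either `r` is that letter and cancels it, or its conjugate lies in
the set of the remaining word, and the deletion happens there. -/
theorem exchange (h : InversionCocycle σ N) (ω : List B) (r : G) (hr : r ∈ N (ω.map σ).prod) :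
    ∃ k < ω.length, r * (ω.map σ).prod = ((ω.eraseIdx k).map σ).prod := by
  induction ω generalizing r with
  | nil => simp [h.map_one] at hr
  | cons i ω ih =>
    rw [List.map_cons, List.prod_cons, h.mem_simple_mul] at hr
    rcases hr with ⟨rfl, -⟩ | ⟨hr, -⟩
    · refine ⟨0, by simp, ?_⟩
      simp [← mul_assoc, h.mul_self]
    · obtain ⟨k, hk, hk'⟩ := ih _ hr
      refine ⟨k + 1, by simpa using hk, ?_⟩
      rw [List.eraseIdx_cons_succ, List.map_cons, List.prod_cons, List.map_cons, List.prod_cons,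
        ← hk', ← mul_assoc, ← mul_assoc, ← mul_assoc, ← mul_assoc, h.mul_self, one_mul]

/-- The cocycle sees words from the left, so prefixes need an argument: if the first letter could be
exchanged within the prefix, the whole word would have a shorter expression. -/
theorem reduced_append_singleton (h : InversionCocycle σ N) {i : B} {ω : List B}
    (hω : Reduced σ N (ω ++ [i])) : Reduced σ N ω := by
  induction ω with
  | nil => simp [Reduced, h.map_one]
  | cons j ω ih =>
    rw [List.cons_append] at hω
    obtain ⟨h1, h2⟩ := hω.tail h
    refine h.reduced_cons (ih h1) fun hj => h2 ?_
    obtain ⟨k, hk, hk'⟩ := h.exchange _ _ hj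
    exfalso
    have h3 : ((j :: (ω ++ [i])).map σ).prod = (((ω.eraseIdx k) ++ [i]).map σ).prod := by
      rw [List.map_append, List.prod_append, ← hk']
      simp [mul_assoc]
    have h4 := h.ncard_prod_le ((ω.eraseIdx k) ++ [i])
    have h5 : (N ((j :: (ω ++ [i])).map σ).prod).ncard = _ := hω
    rw [h3] at h5
    simp only [List.length_append, List.length_cons, List.length_eraseIdx, hk, if_true] at h4 h5
    omega

/-! ### Matsumoto's theorem for reduced words -/

section Matsumoto

variable {W : Type*} [Group W] {τ : B → W}

/-- Two reduced words with the same product in `G` have the same product in every group generated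
by involutions `τ i` that satisfies the dihedral relations of `G`. -/
theorem prod_eq_of_reduced (h : InversionCocycle σ N) (hτ : ∀ i, τ i * τ i = 1)
    (hrel : ∀ i j n, (σ i * σ j) ^ n = 1 → (τ i * τ j) ^ n = 1) (n : ℕ) :
    ∀ ω ω' : List B, ω.length = n → ω'.length = n → Reduced σ N ω → Reduced σ N ω' →
      (ω.map σ).prod = (ω'.map σ).prod → (ω.map τ).prod = (ω'.map τ).prod := by
  induction n with
  | zero =>
    intro ω ω' hω hω' _ _ _
    rw [List.length_eq_zero_iff] at hω hω'
    simp [hω, hω']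
  | succ n ih =>
    by_contra! hbad
    have first : ∀ (i : B) (a b : List B), (i :: a).length = n + 1 → (i :: b).length = n + 1 →
        Reduced σ N (i :: a) → Reduced σ N (i :: b) →
        ((i :: a).map σ).prod = ((i :: b).map σ).prod →
        ((i :: a).map τ).prod = ((i :: b).map τ).prod := by
      intro i a b ha hb hra hrb hab
      simp only [List.map_cons, List.prod_cons, mul_right_inj] at hab ⊢
      exact ih a b (by simpa using ha) (by simpa using hb) (hra.tail h).1 (hrb.tail h).1 hab
    have last : ∀ (i : B) (a b : List B), (a ++ [i]).length = n + 1 → (b ++ [i]).length = n + 1 →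
        Reduced σ N (a ++ [i]) → Reduced σ N (b ++ [i]) →
        ((a ++ [i]).map σ).prod = ((b ++ [i]).map σ).prod →
        ((a ++ [i]).map τ).prod = ((b ++ [i]).map τ).prod := by
      intro i a b ha hb hra hrb hab
      simp only [List.map_append, List.prod_append, mul_left_inj] at hab ⊢
      exact ih a b (by simpa using ha) (by simpa using hb) (h.reduced_append_singleton hra)
        (h.reduced_append_singleton hrb) hab
    -- A counterexample of minimal length, with the first letters of its two words recorded. By
    -- `first` and `last` its words can share neither first nor last letter.
    let Bad : B → B → List B → List B → Prop := fun i j ω ω' =>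
      ω.length = n + 1 ∧ ω'.length = n + 1 ∧ Reduced σ N ω ∧ Reduced σ N ω' ∧
      (ω.map σ).prod = (ω'.map σ).prod ∧ (ω.map τ).prod ≠ (ω'.map τ).prod ∧
      ω.head? = some i ∧ ω'.head? = some j
    have step : ∀ i j ω ω', Bad i j ω ω' → Bad j i ω' (i :: ω'.dropLast) := by
      rintro i j ω ω' ⟨hl, hl', hr, hr', hp, hne, hi, hj⟩
      obtain ⟨a, rfl⟩ : ∃ a, ω = i :: a := by
        cases ω with
        | nil => simp at hl
        | cons x a => simp at hi; exact ⟨a, by rw [hi]⟩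
      have hmem := h.head_mem hr
      rw [hp] at hmem
      obtain ⟨k, hk, hk'⟩ := h.exchange _ _ hmem
      have hpk : ((i :: ω'.eraseIdx k).map σ).prod = (ω'.map σ).prod := by
        rw [List.map_cons, List.prod_cons, ← hk', ← mul_assoc, h.mul_self, one_mul]
      have hlk : (i :: ω'.eraseIdx k).length = n + 1 := by
        rw [List.length_cons, List.length_eraseIdx, if_pos hk]; omega
      have hrk : Reduced σ N (i :: ω'.eraseIdx k) := by
        unfold Reduced at hr' ⊢
        rw [hpk, hr', hlk, hl']
      have heq := first i a (ω'.eraseIdx k) hl hlk hr hrk (hp.trans hpk.symm)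
      -- If the deleted letter were not the last, the new word would share its first letter with `ω`
      -- and its last letter with `ω'`, so all three would agree in `W`.
      have hkn : k = n := by
        by_contra hkn
        have hk2 : k < n := by omega
        apply hne
        rw [heq]
        have hne' : ω' ≠ [] := by rintro rfl; simp at hl'
        have e1 : ω' = ω'.dropLast ++ [ω'.getLast hne'] := (List.dropLast_append_getLast hne').symm
        have hdl : ω'.dropLast.length = n := by simp [hl']
        have e2 : i :: ω'.eraseIdx k = (i :: ω'.dropLast.eraseIdx k) ++ [ω'.getLast hne'] := by
          conv_lhs => rw [e1]
          rw [List.eraseIdx_append_of_lt_length (by omega)]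
          rfl
        rw [e2] at hlk hrk hpk ⊢
        generalize ω'.getLast hne' = x at *
        generalize ω'.dropLast = y at *
        subst e1
        exact last _ _ _ hlk hl' hrk hr' hpk
      subst hkn
      have e3 : ω'.eraseIdx k = ω'.dropLast := by
        rw [List.dropLast_eq_take, List.eraseIdx_eq_take_drop_succ, hl']
        simp [hl']
      rw [e3] at hlk hrk hpk heq
      exact ⟨hl', hlk, hr', hrk, hpk.symm, by rw [← heq]; exact hne.symm, hj, by simp⟩
    -- Each application of `step` prepends `i` or `j` in turn, so after `t` steps the second word
    -- starts with `t` alternating letters.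
    have alt : ∀ t ≤ n + 1, ∃ i j ω ω', Bad i j ω ω' ∧ ω'.take t = altWord t j i := by
      intro t
      induction t with
      | zero =>
        intro _
        obtain ⟨ω, ω', hl, hl', hr, hr', hp, hne⟩ := hbad
        cases ω with
        | nil => simp at hl
        | cons i a =>
        cases ω' with
        | nil => simp at hl'
        | cons j b => exact ⟨i, j, _, _, ⟨hl, hl', hr, hr', hp, hne, rfl, rfl⟩, by simp [altWord]⟩
      | succ t iht =>
        intro ht
        obtain ⟨i, j, ω, ω', hB, hal⟩ := iht (by omega)
        refine ⟨j, i, _, _, step i j ω ω' hB, ?_⟩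
        rw [List.take_succ_cons, altWord, ← hal, List.dropLast_eq_take, List.take_take, hB.2.1]
        congr 2
        omega
    obtain ⟨i, j, ω, ω', hB, hal⟩ := alt (n + 1) le_rfl
    have hω' : ω' = altWord (n + 1) j i := by
      rw [← hal, List.take_of_length_le (by rw [hB.2.1])]
    have hB' := step i j ω ω' hB
    have hω'' : i :: ω'.dropLast = altWord (n + 1) i j := by
      rw [altWord]
      congr 1
      have : (altWord (n + 1) j i).dropLast = altWord n j i := by
        clear * -
        induction n generalizing i j with
        | zero => rfl
        | succ n ih =>
          rw [altWord, List.dropLast_cons_of_ne_nil (by simp [altWord]), ih, ← altWord]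
      rw [hω', this]
    rw [hω'', hω'] at hB'
    obtain ⟨-, -, -, -, hp, hne, -, -⟩ := hB'
    -- Both words now alternate in the same two letters, so their equality in `G` is a dihedral
    -- relation, which `hrel` carries over to `W`.
    rw [prod_altWord σ h.mul_self, mul_eq_right] at hp
    apply hne
    rw [prod_altWord τ hτ, hrel _ _ _ hp, one_mul]

/-- Every element of a group generated by involutions satisfying the dihedral relations of `G` is
the product of a word that is reduced in `G`. -/
theorem exists_reduced (h : InversionCocycle σ N) (hτ : ∀ i, τ i * τ i = 1)
    (hrel : ∀ i j n, (σ i * σ j) ^ n = 1 → (τ i * τ j) ^ n = 1) (ω : List B) :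
    ∃ ω', Reduced σ N ω' ∧ (ω'.map τ).prod = (ω.map τ).prod := by
  induction ω with
  | nil => exact ⟨[], by simp [Reduced, h.map_one], rfl⟩
  | cons i ω ih =>
    obtain ⟨ω', hr, hp⟩ := ih
    by_cases hi : σ i ∈ N (ω'.map σ).prod
    · obtain ⟨k, hk, hk'⟩ := h.exchange _ _ hi
      have hpk : ((i :: ω'.eraseIdx k).map σ).prod = (ω'.map σ).prod := by
        rw [List.map_cons, List.prod_cons, ← hk', ← mul_assoc, h.mul_self, one_mul]
      have hlk : (i :: ω'.eraseIdx k).length = ω'.length := by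
        rw [List.length_cons, List.length_eraseIdx, if_pos hk]; omega
      have hrk : Reduced σ N (i :: ω'.eraseIdx k) := by
        unfold Reduced at hr ⊢
        rw [hpk, hr, hlk]
      have := h.prod_eq_of_reduced hτ hrel _ _ _ hlk rfl hrk hr hpk
      refine ⟨ω'.eraseIdx k, (hrk.tail h).1, ?_⟩
      rw [List.map_cons, List.prod_cons, ← hp, ← this, List.map_cons, List.prod_cons, ← mul_assoc,
        hτ, one_mul]
    · exact ⟨i :: ω', h.reduced_cons hr hi, by simp [hp]⟩

end Matsumoto

theorem exists_word (h : InversionCocycle σ N) (n : ℕ) (g : G) (hg : (N g).ncard = n) :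
    ∃ ω : List B, (ω.map σ).prod = g := by
  induction n generalizing g with
  | zero =>
    refine ⟨[], ?_⟩
    by_contra hne
    obtain ⟨i, hi⟩ := h.exists_mem g (fun h => hne (by simp [h]))
    rw [Set.ncard_eq_zero (h.finite g)] at hg
    simp [hg] at hi
  | succ n ih =>
    have hne : g ≠ 1 := by
      rintro rfl
      simp [h.map_one] at hg
    obtain ⟨i, hi⟩ := h.exists_mem g hne
    have := h.ncard_simple_mul_of_mem i g hi
    obtain ⟨ω, hω⟩ := ih (σ i * g) (by omega)
    exact ⟨i :: ω, by rw [List.map_cons, List.prod_cons, hω, ← mul_assoc, h.mul_self, one_mul]⟩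

/-- An element of the kernel of the map from the presented group is represented by a reduced word,
whose length is the cardinality of `N 1`, that is, zero. Surjectivity is descent on the cardinality
of `N g`. -/
theorem exists_coxeterSystem (h : InversionCocycle σ N) :
    ∃ M : CoxeterMatrix B, Nonempty (CoxeterSystem M G) := by
  -- `orderOf` is `0` for elements of infinite order, which agrees with the encoding of `∞`.
  let M : CoxeterMatrix B :=
    { M := Matrix.of fun i j => orderOf (σ i * σ j)
      isSymm := by
        ext i j
        simp only [Matrix.transpose_apply, Matrix.of_apply]
        rw [← orderOf_inv, mul_inv_rev, h.inv_simple, h.inv_simple]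
      diagonal := fun i => by simp [h.mul_self]
      off_diagonal := fun i j hij => by
        rw [Matrix.of_apply, Ne, orderOf_eq_one_iff]
        intro hc
        apply hij
        apply h.injective
        rw [eq_inv_of_mul_eq_one_left hc, h.inv_simple] }
  have hM : ∀ i j, M i j = orderOf (σ i * σ j) := fun i j => rfl
  let cs := M.toCoxeterSystem
  have hl : M.IsLiftable σ := fun i j => by rw [hM]; exact pow_orderOf_eq_one _
  let φ : M.Group →* G := cs.lift ⟨σ, hl⟩
  have hφ : ∀ ω : List B, φ (ω.map cs.simple).prod = (ω.map σ).prod := by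
    intro ω
    rw [map_list_prod, List.map_map]
    congr 2
    ext i
    exact cs.lift_apply_simple hl i
  have hrel : ∀ i j n, (σ i * σ j) ^ n = 1 → (cs.simple i * cs.simple j) ^ n = 1 := by
    intro i j n hn
    obtain ⟨k, rfl⟩ := orderOf_dvd_of_pow_eq_one hn
    rw [← hM, pow_mul, cs.simple_mul_simple_pow, one_pow]
  have hinj : Function.Injective φ := by
    rw [injective_iff_map_eq_one]
    intro w hw
    obtain ⟨ω, rfl⟩ := cs.wordProd_surjective w
    obtain ⟨ω', hr, hp⟩ := h.exists_reduced cs.simple_mul_simple_self hrel ω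
    rw [CoxeterSystem.wordProd, ← hp] at hw ⊢
    rw [hφ] at hw
    unfold Reduced at hr
    rw [hw, h.map_one, Set.ncard_empty] at hr
    rw [List.length_eq_zero_iff.1 hr.symm]
    rfl
  have hsurj : Function.Surjective φ := by
    intro g
    obtain ⟨ω, hω⟩ := h.exists_word _ g rfl
    exact ⟨_, (hφ ω).trans hω⟩
  exact ⟨M, ⟨cs.map (MulEquiv.ofBijective φ ⟨hinj, hsurj⟩)⟩⟩

end InversionCocycle

/-! ### Geodesics, walls and sides -/

section Sides

variable {X : Type v} [MetricSpace X]

theorem IsGeodesic.continuousOn {ξ : ℝ → X} {x y : X} (h : IsGeodesic ξ x y) :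
    ContinuousOn ξ (Set.Icc 0 (dist x y)) := by
  have : LipschitzOnWith 1 ξ (Set.Icc 0 (dist x y)) :=
    LipschitzOnWith.of_dist_le_mul fun s hs t ht => by
      rw [h.1 s hs t ht, Real.dist_eq]; simp
  exact this.continuousOn

theorem IsGeodesic.isPreconnected_image {ξ : ℝ → X} {x y : X} (h : IsGeodesic ξ x y) {a : ℝ}
    (ha : a ≤ dist x y) : IsPreconnected (ξ '' Set.Icc 0 a) :=
  isPreconnected_Icc.image _ (h.continuousOn.mono (Set.Icc_subset_Icc_right ha))

theorem IsGeodesic.dist_left {ξ : ℝ → X} {x y : X} (h : IsGeodesic ξ x y) {t : ℝ}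
    (ht : t ∈ Set.Icc 0 (dist x y)) : dist x (ξ t) = t := by
  have := h.1 0 ⟨le_rfl, dist_nonneg⟩ t ht
  rw [h.2.1] at this
  rw [this, zero_sub, abs_neg, abs_of_nonneg ht.1]

theorem IsGeodesic.dist_right {ξ : ℝ → X} {x y : X} (h : IsGeodesic ξ x y) {t : ℝ}
    (ht : t ∈ Set.Icc 0 (dist x y)) : dist (ξ t) y = dist x y - t := by
  have := h.1 t ht (dist x y) ⟨dist_nonneg, le_rfl⟩
  rw [h.2.2] at this
  rw [this, abs_sub_comm, abs_of_nonneg (by linarith [ht.2])]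

theorem IsGeodesic.map {ξ : ℝ → X} {x y : X} (h : IsGeodesic ξ x y) (g : X ≃ᵢ X) :
    IsGeodesic (fun t => g (ξ t)) (g x) (g y) := by
  refine ⟨?_, ?_, ?_⟩
  · intro s hs t ht
    rw [g.dist_eq] at hs ht
    rw [g.dist_eq, h.1 s hs t ht]
  · simp [h.2.1]
  · simp only [g.dist_eq, h.2.2]

theorem IsGeodesicallyConvex.image {A : Set X} (hA : IsGeodesicallyConvex A) (g : X ≃ᵢ X) :
    IsGeodesicallyConvex (g '' A) := by
  rintro _ ⟨x, hx, rfl⟩ _ ⟨y, hy, rfl⟩ ξ hξ t ht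
  have h := hξ.map g.symm
  simp only [IsometryEquiv.symm_apply_apply] at h
  rw [g.dist_eq] at ht
  exact ⟨_, hA x hx y hy _ h t ht, by simp⟩

theorem isClosed_wall (r : X ≃ᵢ X) : IsClosed (wall r) :=
  isClosed_eq r.continuous continuous_id

theorem mem_wall_conj (g r : X ≃ᵢ X) (x : X) : g x ∈ wall (g * r * g⁻¹) ↔ x ∈ wall r := by
  simp [wall, IsometryEquiv.mul_apply]

theorem image_wall (g r : X ≃ᵢ X) : g '' wall r = wall (g * r * g⁻¹) := by
  ext x
  constructor
  · rintro ⟨y, hy, rfl⟩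
    rwa [mem_wall_conj]
  · intro hx
    refine ⟨g⁻¹ x, ?_, by simp⟩
    rw [← mem_wall_conj g]
    simpa using hx

theorem connectedComponentsOf_image (g : X ≃ᵢ X) (U : Set X) :
    connectedComponentsOf (g '' U) = Set.image g '' connectedComponentsOf U := by
  ext C
  constructor
  · rintro ⟨_, ⟨x, hx, rfl⟩, rfl⟩
    exact ⟨_, ⟨x, hx, rfl⟩, g.toHomeomorph.image_connectedComponentIn hx⟩
  · rintro ⟨_, ⟨x, hx, rfl⟩, rfl⟩
    exact ⟨_, ⟨x, hx, rfl⟩, g.toHomeomorph.image_connectedComponentIn hx⟩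

theorem IsReflection.conj {r : X ≃ᵢ X} (hr : IsReflection r) (g : X ≃ᵢ X) :
    IsReflection (g * r * g⁻¹) := by
  have hcompl : (wall (g * r * g⁻¹))ᶜ = g '' (wall r)ᶜ := by
    rw [Set.image_compl_eq g.bijective, image_wall]
  refine ⟨fun x => ?_, ?_, ?_, ?_⟩
  · simp [IsometryEquiv.mul_apply, hr.1]
  · rw [hcompl, connectedComponentsOf_image,
      Set.ncard_image_of_injective _ (Set.image_injective.2 g.injective)]
    exact hr.2.1
  · rw [hcompl, connectedComponentsOf_image]
    rintro _ ⟨A, hA, rfl⟩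
    exact (hr.2.2.1 A hA).image g
  · rw [← image_wall]
    have := g.toHomeomorph.image_interior (wall r)
    rw [hr.2.2.2, Set.image_empty] at this
    exact this.symm

theorem IsReflection.mul_self {r : X ≃ᵢ X} (hr : IsReflection r) : r * r = 1 := by
  ext x
  exact hr.1 x

theorem not_isReflection_one [Nonempty X] : ¬ IsReflection (1 : X ≃ᵢ X) := by
  intro h
  have h1 : wall (1 : X ≃ᵢ X) = Set.univ := by ext; simp [wall]
  have := h.2.2.2
  rw [h1, interior_univ] at this
  exact Set.univ_nonempty.ne_empty this

/-- Two points lie on the same side of the wall of `r`. -/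
def SameSide (r : X ≃ᵢ X) (x y : X) : Prop :=
  ∃ K : Set X, IsPreconnected K ∧ K ⊆ (wall r)ᶜ ∧ x ∈ K ∧ y ∈ K

theorem SameSide.symm {r : X ≃ᵢ X} {x y : X} (h : SameSide r x y) : SameSide r y x := by
  obtain ⟨K, h1, h2, h3, h4⟩ := h
  exact ⟨K, h1, h2, h4, h3⟩

theorem SameSide.trans {r : X ≃ᵢ X} {x y z : X} (h : SameSide r x y) (h' : SameSide r y z) :
    SameSide r x z := by
  obtain ⟨K, h1, h2, h3, h4⟩ := h
  obtain ⟨L, h1', h2', h3', h4'⟩ := h'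
  exact ⟨K ∪ L, h1.union y h4 h3' h1', Set.union_subset h2 h2', Or.inl h3, Or.inr h4'⟩

theorem SameSide.mem_connectedComponentIn {r : X ≃ᵢ X} {x y : X} (h : SameSide r x y) :
    y ∈ connectedComponentIn (wall r)ᶜ x := by
  obtain ⟨K, h1, h2, h3, h4⟩ := h
  exact h1.subset_connectedComponentIn h3 h2 h4

theorem sameSide_of_mem {r : X ≃ᵢ X} {x y : X} (h : y ∈ connectedComponentIn (wall r)ᶜ x) :
    SameSide r x y := by
  have hx : x ∈ (wall r)ᶜ := connectedComponentIn_nonempty_iff.1 ⟨y, h⟩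
  exact ⟨_, isPreconnected_connectedComponentIn, connectedComponentIn_subset _ _,
    mem_connectedComponentIn hx, h⟩

theorem SameSide.conj {r : X ≃ᵢ X} {x y : X} (h : SameSide r x y) (g : X ≃ᵢ X) :
    SameSide (g * r * g⁻¹) (g x) (g y) := by
  obtain ⟨K, h1, h2, h3, h4⟩ := h
  refine ⟨g '' K, h1.image _ g.continuous.continuousOn, ?_, ⟨x, h3, rfl⟩, ⟨y, h4, rfl⟩⟩
  rintro _ ⟨z, hz, rfl⟩ hz'
  rw [mem_wall_conj] at hz'
  exact h2 hz hz'

theorem sameSide_conj_iff (r g : X ≃ᵢ X) (x y : X) :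
    SameSide (g⁻¹ * r * g) x y ↔ SameSide r (g x) (g y) := by
  constructor
  · intro h
    have := h.conj g
    rwa [show g * (g⁻¹ * r * g) * g⁻¹ = r by group] at this
  · intro h
    have := h.conj g⁻¹
    rw [inv_inv] at this
    simpa using this

/-- Pigeonhole: three points, two components. -/
theorem IsReflection.sameSide_of_not {r : X ≃ᵢ X} (hr : IsReflection r) {x y z : X}
    (hx : x ∉ wall r) (hy : y ∉ wall r) (hz : z ∉ wall r) (hxy : ¬ SameSide r x y)
    (hyz : ¬ SameSide r y z) : SameSide r x z := by
  obtain ⟨A, B, -, hAB⟩ := Set.ncard_eq_two.1 hr.2.1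
  have key : ∀ p, p ∉ wall r → connectedComponentIn (wall r)ᶜ p = A ∨
      connectedComponentIn (wall r)ᶜ p = B := fun p hp => by
    have : connectedComponentIn (wall r)ᶜ p ∈ connectedComponentsOf (wall r)ᶜ := ⟨p, hp, rfl⟩
    rw [hAB] at this
    exact this
  have key2 : ∀ p q, q ∉ wall r → connectedComponentIn (wall r)ᶜ p =
      connectedComponentIn (wall r)ᶜ q → SameSide r p q := fun p q hq h =>
    sameSide_of_mem (by rw [h]; exact mem_connectedComponentIn hq)
  have h1 := key x hx
  have h2 := key y hy
  have h3 := key z hz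
  have h4 := mt (key2 x y hy) hxy
  have h5 := mt (key2 y z hz) hyz
  apply key2 x z hz
  grind

/-- This is the source of the cocycle law: separation by a fixed wall is additive modulo 2. -/
theorem IsReflection.not_sameSide_iff_xor {r : X ≃ᵢ X} (hr : IsReflection r) {x y z : X}
    (hx : x ∉ wall r) (hy : y ∉ wall r) (hz : z ∉ wall r) :
    ¬ SameSide r x z ↔ Xor (¬ SameSide r x y) (¬ SameSide r y z) := by
  have t1 := hr.sameSide_of_not hx hy hz
  have t2 : SameSide r x y → SameSide r y z → SameSide r x z := SameSide.trans
  have t3 : SameSide r x y → SameSide r x z → SameSide r y z := fun h h' => h.symm.trans h'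
  have t4 : SameSide r y z → SameSide r x z → SameSide r x y := fun h h' => h'.trans h.symm
  unfold Xor
  tauto

theorem IsReflection.notMem_wall_of_sameSide {r : X ≃ᵢ X} (hr : IsReflection r) {x y : X}
    (h : SameSide r x y) {ξ : ℝ → X} (hξ : IsGeodesic ξ x y) {t : ℝ}
    (ht : t ∈ Set.Icc 0 (dist x y)) : ξ t ∉ wall r := by
  have hx : x ∉ wall r := by
    obtain ⟨K, -, h2, h3, -⟩ := h
    exact h2 h3
  have := hr.2.2.1 _ ⟨x, hx, rfl⟩ x (mem_connectedComponentIn hx) y h.mem_connectedComponentIn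
    ξ hξ t ht
  exact connectedComponentIn_subset _ _ this

theorem IsGeodesic.exists_mem_wall {r : X ≃ᵢ X} {x y : X} (h : ¬ SameSide r x y) {ξ : ℝ → X}
    (hξ : IsGeodesic ξ x y) : ∃ t ∈ Set.Icc 0 (dist x y), ξ t ∈ wall r := by
  by_contra! hc
  apply h
  refine ⟨ξ '' Set.Icc 0 (dist x y), hξ.isPreconnected_image le_rfl, ?_,
    ⟨0, ⟨le_rfl, dist_nonneg⟩, hξ.2.1⟩, ⟨_, ⟨dist_nonneg, le_rfl⟩, hξ.2.2⟩⟩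
  rintro _ ⟨t, ht, rfl⟩
  exact hc t ht

theorem dist_apply_le_of_mem_wall {r : X ≃ᵢ X} {x y : X} (hy : y ∈ wall r) :
    dist (r x) x ≤ 2 * dist x y := by
  have h1 : dist (r x) y = dist x y := by
    conv_lhs => rw [← (show r y = y from hy)]
    exact r.dist_eq x y
  have := dist_triangle (r x) y x
  rw [h1, dist_comm y x] at this
  linarith

end Sides

/-! ### Chambers, separating walls and simple reflections -/

section Chambers

variable {X : Type v} [MetricSpace X]

/-- The reflections belonging to a group of isometries. -/
def reflectionsIn (G : Subgroup (X ≃ᵢ X)) : Set (X ≃ᵢ X) := {r | r ∈ G ∧ IsReflection r}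

/-- The complement of the walls of the reflections in `G`. -/
def offWalls (G : Subgroup (X ≃ᵢ X)) : Set X := (⋃ r ∈ reflectionsIn G, wall r)ᶜ

/-- The reflections in `G` whose walls separate `x` and `y`. -/
def separating (G : Subgroup (X ≃ᵢ X)) (x y : X) : Set (X ≃ᵢ X) :=
  {r | r ∈ reflectionsIn G ∧ ¬ SameSide r x y}

variable {G : Subgroup (X ≃ᵢ X)}

theorem mem_offWalls {x : X} : x ∈ offWalls G ↔ ∀ r ∈ reflectionsIn G, x ∉ wall r := by
  simp [offWalls]

theorem conj_mem_reflectionsIn {r g : X ≃ᵢ X} (hr : r ∈ reflectionsIn G) (hg : g ∈ G) :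
    g * r * g⁻¹ ∈ reflectionsIn G :=
  ⟨G.mul_mem (G.mul_mem hg hr.1) (G.inv_mem hg), hr.2.conj g⟩

theorem conj_mem_reflectionsIn' {r g : X ≃ᵢ X} (hr : r ∈ reflectionsIn G) (hg : g ∈ G) :
    g⁻¹ * r * g ∈ reflectionsIn G := by
  simpa using conj_mem_reflectionsIn hr (G.inv_mem hg)

theorem apply_mem_offWalls {x : X} (hx : x ∈ offWalls G) {g : X ≃ᵢ X} (hg : g ∈ G) :
    g x ∈ offWalls G := by
  rw [mem_offWalls] at hx ⊢
  intro r hr hgx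
  apply hx _ (conj_mem_reflectionsIn' hr hg)
  rw [← mem_wall_conj g]
  rwa [show g * (g⁻¹ * r * g) * g⁻¹ = r by group]

/-- A separating wall meets a geodesic from `x` to `y`, so its reflection moves `x` by at most `2 *
dist x y`; properness leaves finitely many. -/
theorem finite_separating (hX : IsGeodesicSpace X) (hp : IsProperIsometryGroup G) (x y : X) :
    (separating G x y).Finite := by
  refine (hp x (2 * dist x y + 1) (by positivity)).subset ?_
  rintro r ⟨hr, hs⟩
  obtain ⟨ξ, hξ⟩ := hX x y
  obtain ⟨t, ht, hw⟩ := hξ.exists_mem_wall hs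
  refine ⟨hr.1, ?_⟩
  rw [Metric.mem_ball]
  have := dist_apply_le_of_mem_wall (x := x) hw
  rw [hξ.dist_left ht] at this
  linarith [ht.2]

/-- The first point at which a geodesic leaving the complement of the walls meets a wall. -/
theorem exists_first_wall (hX : IsGeodesicSpace X) (hp : IsProperIsometryGroup G) {x y : X}
    (hx : x ∈ offWalls G) (hne : (separating G x y).Nonempty) {ξ : ℝ → X}
    (hξ : IsGeodesic ξ x y) :
    ∃ a ∈ Set.Icc 0 (dist x y), 0 < a ∧ (∃ r ∈ reflectionsIn G, ξ a ∈ wall r) ∧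
      ∀ t ∈ Set.Ico 0 a, ξ t ∈ offWalls G := by
  -- By convexity of the sides, a wall that does not separate `x` from `y` misses the geodesic. Only
  -- finitely many closed sets remain, so a first hitting time exists.
  let T : Set ℝ := ⋃ r ∈ separating G x y, Set.Icc 0 (dist x y) ∩ ξ ⁻¹' wall r
  have hT : IsCompact T := by
    refine (finite_separating hX hp x y).isCompact_biUnion fun r _ => ?_
    exact isCompact_Icc.of_isClosed_subset
      (hξ.continuousOn.preimage_isClosed_of_isClosed isClosed_Icc (isClosed_wall r))
      Set.inter_subset_left
  have hTne : T.Nonempty := by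
    obtain ⟨r, hr⟩ := hne
    obtain ⟨t, ht, hw⟩ := hξ.exists_mem_wall hr.2
    exact ⟨t, Set.mem_biUnion hr ⟨ht, hw⟩⟩
  obtain ⟨a, haT, ha⟩ := hT.exists_isLeast hTne
  obtain ⟨r, hr, haI, haw⟩ := Set.mem_iUnion₂.1 haT
  refine ⟨a, haI, ?_, ⟨r, hr.1, haw⟩, ?_⟩
  · refine lt_of_le_of_ne haI.1 ?_
    rintro rfl
    rw [Set.mem_preimage, hξ.2.1] at haw
    exact mem_offWalls.1 hx r hr.1 haw
  · intro t ht
    rw [mem_offWalls]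
    intro q hq hw
    have htI : t ∈ Set.Icc 0 (dist x y) := ⟨ht.1, ht.2.le.trans haI.2⟩
    by_cases hs : SameSide q x y
    · exact hq.2.notMem_wall_of_sameSide hs hξ htI hw
    · exact absurd (ha (Set.mem_biUnion (show q ∈ separating G x y from ⟨hq, hs⟩) ⟨htI, hw⟩))
        (not_le.2 ht.2)

/-- A chamber is an intersection of sides: points on the same side of every wall are joined by a
geodesic which, by convexity, meets no wall. -/
theorem mem_chamber_iff (hX : IsGeodesicSpace X) {x y : X} (hx : x ∈ offWalls G) :
    y ∈ connectedComponentIn (offWalls G) x ↔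
      y ∈ offWalls G ∧ ∀ r ∈ reflectionsIn G, SameSide r x y := by
  constructor
  · intro h
    refine ⟨connectedComponentIn_subset _ _ h, fun r hr => ⟨_, isPreconnected_connectedComponentIn,
      ?_, mem_connectedComponentIn hx, h⟩⟩
    exact fun z hz => mem_offWalls.1 (connectedComponentIn_subset _ _ hz) r hr
  · rintro ⟨-, hs⟩
    obtain ⟨ξ, hξ⟩ := hX x y
    refine (hξ.isPreconnected_image le_rfl).subset_connectedComponentIn
      ⟨0, ⟨le_rfl, dist_nonneg⟩, hξ.2.1⟩ ?_ ⟨_, ⟨dist_nonneg, le_rfl⟩, hξ.2.2⟩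
    rintro _ ⟨t, ht, rfl⟩
    rw [mem_offWalls]
    exact fun r hr => hr.2.notMem_wall_of_sameSide (hs r hr) hξ ht

/-- If no wall separates `x` from `g x`, then `g` preserves the chamber of `x`, hence lies in its
trivial stabilizer. -/
theorem eq_one_of_sameSide (hX : IsGeodesicSpace X) {x : X} (hx : x ∈ offWalls G)
    (hstab : {g : X ≃ᵢ X | g ∈ G ∧ connectedComponentIn (offWalls G) x =
      g '' connectedComponentIn (offWalls G) x} = {1}) {g : X ≃ᵢ X} (hg : g ∈ G)
    (hs : ∀ r ∈ reflectionsIn G, SameSide r x (g x)) : g = 1 := by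
  suffices g ∈ {g : X ≃ᵢ X | g ∈ G ∧ connectedComponentIn (offWalls G) x =
      g '' connectedComponentIn (offWalls G) x} by
    rw [hstab] at this
    exact this
  refine ⟨hg, ?_⟩
  have key : ∀ y, g y ∈ connectedComponentIn (offWalls G) x ↔
      y ∈ connectedComponentIn (offWalls G) x := by
    intro y
    rw [mem_chamber_iff hX hx, mem_chamber_iff hX hx]
    refine and_congr ⟨fun h => ?_, fun h => apply_mem_offWalls h hg⟩ ⟨fun h r hr => ?_,
      fun h r hr => ?_⟩
    · simpa using apply_mem_offWalls h (G.inv_mem hg)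
    · have h1 := conj_mem_reflectionsIn hr hg
      have h2 := (hs _ h1).symm.trans (h _ h1)
      rw [← sameSide_conj_iff] at h2
      rwa [show g⁻¹ * (g * r * g⁻¹) * g = r by group] at h2
    · refine (hs r hr).trans ?_
      rw [← sameSide_conj_iff]
      exact h _ (conj_mem_reflectionsIn' hr hg)
  ext y
  constructor
  · intro hy
    refine ⟨g⁻¹ y, ?_, by simp⟩
    rw [← key]
    simpa using hy
  · rintro ⟨z, hz, rfl⟩
    rwa [key]

/-- The reflections of `G` in the walls adjacent to the chamber of `x`. -/
def simpleReflections (G : Subgroup (X ≃ᵢ X)) (x : X) : Set (X ≃ᵢ X) :=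
  {s | s ∈ reflectionsIn G ∧ separating G x (s x) = {s}}

/-- A geodesic leaving a chamber crosses the wall of a simple reflection. -/
theorem exists_simple_mem_separating (hX : IsGeodesicSpace X) (hp : IsProperIsometryGroup G)
    {x : X} (hx : x ∈ offWalls G)
    (hfree : ∀ g ∈ G, (∀ r ∈ reflectionsIn G, SameSide r x (g x)) → g = 1) {y : X}
    (hy : y ∈ offWalls G) (hne : (separating G x y).Nonempty) :
    ∃ s ∈ simpleReflections G x, s ∈ separating G x y := by
  have : Nonempty X := ⟨x⟩
  induction hn : (separating G x y).ncard using Nat.strong_induction_on generalizing y with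
  | _ n ih =>
  obtain ⟨ξ, hξ⟩ := hX x y
  obtain ⟨a, ha, ha0, ⟨r, hr, hra⟩, hat⟩ := exists_first_wall hX hp hx hne hξ
  have hsub : ∀ q ∈ reflectionsIn G, ξ a ∈ wall q → q ∈ separating G x y := fun q hq hqa =>
    ⟨hq, fun hs => hq.2.notMem_wall_of_sameSide hs hξ ha hqa⟩
  have hlocal : ∀ p ∈ reflectionsIn G, ξ a ∈ wall p →
      ∀ q ∈ separating G x (p x), ξ a ∈ wall q := by
    intro p hp' hpa q hq
    by_contra hqa
    apply hq.2
    have hK := hξ.isPreconnected_image ha.2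
    have haK : ξ a ∈ ξ '' Set.Icc 0 a := ⟨a, ⟨ha0.le, le_rfl⟩, rfl⟩
    have h0K : x ∈ ξ '' Set.Icc 0 a := ⟨0, ⟨le_rfl, ha0.le⟩, hξ.2.1⟩
    -- Follow the geodesic to `ξ a`, which `p` fixes, and return along its image under `p`. This
    -- path from `x` to `p x` can meet walls only at `ξ a`.
    refine ⟨ξ '' Set.Icc 0 a ∪ p '' (ξ '' Set.Icc 0 a), ?_, ?_, Or.inl h0K, Or.inr ⟨x, h0K, rfl⟩⟩
    · exact hK.union (ξ a) haK ⟨ξ a, haK, hpa⟩ (hK.image _ p.continuous.continuousOn)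
    · rintro _ (⟨t, ht, rfl⟩ | ⟨_, ⟨t, ht, rfl⟩, rfl⟩)
      · rcases ht.2.eq_or_lt with rfl | hlt
        · exact hqa
        · exact mem_offWalls.1 (hat t ⟨ht.1, hlt⟩) q hq.1
      · rcases ht.2.eq_or_lt with rfl | hlt
        · rw [show p (ξ t) = ξ t from hpa]
          exact hqa
        · exact mem_offWalls.1 (apply_mem_offWalls (hat t ⟨ht.1, hlt⟩) hp'.1) q hq.1
  have hnonempty : ∀ p ∈ reflectionsIn G, (separating G x (p x)).Nonempty := by
    intro p hp'
    by_contra hempty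
    rw [Set.not_nonempty_iff_eq_empty] at hempty
    have : p = 1 := hfree p hp'.1 fun q hq => by
      by_contra hs
      have : q ∈ separating G x (p x) := ⟨hq, hs⟩
      simp [hempty] at this
    exact not_isReflection_one (this ▸ hp'.2)
  have hle : ∀ p ∈ reflectionsIn G, ξ a ∈ wall p → separating G x (p x) ⊆ separating G x y :=
    fun p hp' hpa q hq => hsub q hq.1 (hlocal p hp' hpa q hq)
  -- Either every reflection fixing `ξ a` separates `x` from its image by the same set as for `y`,
  -- and then `r` is simple; or some `p` gives a strictly smaller set, and induction applies to `p
  -- x`.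
  by_cases hall : ∀ p ∈ reflectionsIn G, ξ a ∈ wall p → separating G x (p x) = separating G x y
  · refine ⟨r, ⟨hr, ?_⟩, hsub r hr hra⟩
    rw [hall r hr hra]
    refine Set.eq_singleton_iff_unique_mem.2 ⟨hsub r hr hra, fun q hq => ?_⟩
    have hqa : ξ a ∈ wall q := hlocal r hr hra q (by rwa [hall r hr hra])
    -- The same walls separate `x` from `q x` and from `r x`, so none separates `q x` from `r x`.
    have h1 : q⁻¹ * r = 1 := by
      refine hfree _ (G.mul_mem (G.inv_mem hq.1.1) hr.1) fun p hp' => ?_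
      have h2 := conj_mem_reflectionsIn hp' hq.1.1
      have h3 : ∀ z ∈ reflectionsIn G, ξ a ∈ wall z →
          ((q * p * q⁻¹) ∈ separating G x (z x) ↔ (q * p * q⁻¹) ∈ separating G x y) :=
        fun z hz hza => by rw [hall z hz hza]
      have h4 := h3 q hq.1 hqa
      have h5 := h3 r hr hra
      rw [← h4] at h5
      have h6 : SameSide (q * p * q⁻¹) (q x) (r x) := by
        have hnw : ∀ g ∈ G, g x ∉ wall (q * p * q⁻¹) := fun g hg =>
          mem_offWalls.1 (apply_mem_offWalls hx hg) _ h2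
        have hnx : x ∉ wall (q * p * q⁻¹) := mem_offWalls.1 hx _ h2
        by_cases hs : SameSide (q * p * q⁻¹) x (q x)
        · have : SameSide (q * p * q⁻¹) x (r x) := by
            by_contra hs'
            exact (h5.1 ⟨h2, hs'⟩).2 hs
          exact hs.symm.trans this
        · have : ¬ SameSide (q * p * q⁻¹) x (r x) := (h5.2 ⟨h2, hs⟩).2
          exact h2.2.sameSide_of_not (hnw q hq.1.1) hnx (hnw r hr.1) (fun h => hs h.symm) this
      have h7 := h6.conj q⁻¹
      rw [show q⁻¹ * (q * p * q⁻¹) * q⁻¹⁻¹ = p by group] at h7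
      simpa [IsometryEquiv.mul_apply] using h7
    exact (inv_mul_eq_one.1 h1)
  · push Not at hall
    obtain ⟨p, hp', hpa, hpne⟩ := hall
    have hlt : (separating G x (p x)).ncard < n := by
      rw [← hn]
      exact Set.ncard_lt_ncard ((hle p hp' hpa).ssubset_of_ne hpne) (finite_separating hX hp x y)
    obtain ⟨s, hs, hs'⟩ := ih _ hlt (apply_mem_offWalls hx hp'.1) (hnonempty p hp') rfl
    exact ⟨s, hs, hle p hp' hpa hs'⟩

/-- The first wall met on the way from `x` to `s x` can only be that of `s`, and the meeting point
lies in the compact closed chamber. This bounds the displacement of `x` by `s`. -/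
theorem finite_simpleReflections (hX : IsGeodesicSpace X) (hp : IsProperIsometryGroup G)
    {x : X} (hx : x ∈ offWalls G)
    (hc : IsCompact (closure (connectedComponentIn (offWalls G) x))) :
    (simpleReflections G x).Finite := by
  obtain ⟨D, hD⟩ := hc.isBounded.subset_closedBall x
  refine (hp x (2 * |D| + 1) (by positivity)).subset ?_
  rintro s ⟨hs, hsep⟩
  refine ⟨hs.1, ?_⟩
  obtain ⟨ξ, hξ⟩ := hX x (s x)
  obtain ⟨a, ha, ha0, ⟨r, hr, hra⟩, hat⟩ := exists_first_wall hX hp hx (by simp [hsep]) hξ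
  have hrs : r ∈ separating G x (s x) := ⟨hr, fun h => hr.2.notMem_wall_of_sameSide h hξ ha hra⟩
  rw [hsep, Set.mem_singleton_iff] at hrs
  subst hrs
  have hcl : ξ a ∈ closure (connectedComponentIn (offWalls G) x) := by
    have h1 : ξ '' Set.Ico 0 a ⊆ connectedComponentIn (offWalls G) x := by
      refine (isPreconnected_Ico.image _ (hξ.continuousOn.mono fun t ht =>
        ⟨ht.1, ht.2.le.trans ha.2⟩)).subset_connectedComponentIn ⟨0, ⟨le_rfl, ha0⟩, hξ.2.1⟩ ?_
      rintro _ ⟨t, ht, rfl⟩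
      exact hat t ht
    refine closure_mono h1 ?_
    have h2 : ContinuousWithinAt ξ (Set.Ico 0 a) a :=
      (hξ.continuousOn a ha).mono fun t ht => ⟨ht.1, ht.2.le.trans ha.2⟩
    refine h2.mem_closure_image ?_
    rw [closure_Ico ha0.ne]
    exact ⟨ha0.le, le_rfl⟩
  have h3 := hD hcl
  rw [Metric.mem_closedBall, dist_comm] at h3
  have h4 := dist_apply_le_of_mem_wall (x := x) hra
  rw [Metric.mem_ball]
  linarith [le_abs_self D]

theorem inversionCocycle_of_chamber (hX : IsGeodesicSpace X) (hp : IsProperIsometryGroup G)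
    {x : X} (hx : x ∈ offWalls G)
    (hfree : ∀ g ∈ G, (∀ r ∈ reflectionsIn G, SameSide r x (g x)) → g = 1) :
    InversionCocycle (fun s : simpleReflections G x => (⟨s, s.2.1.1⟩ : G))
      (fun g => {r : G | (r : X ≃ᵢ X) ∈ separating G x ((g : X ≃ᵢ X) x)}) where
  injective s t h := by
    apply Subtype.ext
    exact congrArg (fun g : G => (g : X ≃ᵢ X)) h
  mul_self s := Subtype.ext s.2.1.2.mul_self
  finite g := (finite_separating hX hp x _).preimage Subtype.val_injective.injOn
  mem_mul g h r := by
    by_cases hr : (r : X ≃ᵢ X) ∈ reflectionsIn G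
    · have hr' := conj_mem_reflectionsIn' hr g.2
      have e1 : r ∈ {r : G | (r : X ≃ᵢ X) ∈ separating G x (((g * h : G) : X ≃ᵢ X) x)} ↔
          ¬ SameSide (r : X ≃ᵢ X) x ((g : X ≃ᵢ X) ((h : X ≃ᵢ X) x)) :=
        ⟨fun h => h.2, fun h => ⟨hr, h⟩⟩
      have e2 : r ∈ {r : G | (r : X ≃ᵢ X) ∈ separating G x ((g : X ≃ᵢ X) x)} ↔
          ¬ SameSide (r : X ≃ᵢ X) x ((g : X ≃ᵢ X) x) :=
        ⟨fun h => h.2, fun h => ⟨hr, h⟩⟩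
      have e3 : g⁻¹ * r * g ∈ {r : G | (r : X ≃ᵢ X) ∈ separating G x ((h : X ≃ᵢ X) x)} ↔
          ¬ SameSide (r : X ≃ᵢ X) ((g : X ≃ᵢ X) x) ((g : X ≃ᵢ X) ((h : X ≃ᵢ X) x)) := by
        rw [← sameSide_conj_iff]
        exact ⟨fun h => h.2, fun h => ⟨hr', h⟩⟩
      rw [e1, e2, e3]
      exact hr.2.not_sameSide_iff_xor (mem_offWalls.1 hx _ hr)
        (mem_offWalls.1 (apply_mem_offWalls hx g.2) _ hr)
        (mem_offWalls.1 (apply_mem_offWalls (apply_mem_offWalls hx h.2) g.2) _ hr)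
    · have hr' : ¬ ((g⁻¹ * r * g : G) : X ≃ᵢ X) ∈ reflectionsIn G := fun hc => hr <| by
        have := conj_mem_reflectionsIn hc g.2
        convert this using 1
        push_cast
        group
      have e : ∀ (z : X) (q : G), (q : X ≃ᵢ X) ∉ reflectionsIn G →
          (q ∈ {r : G | (r : X ≃ᵢ X) ∈ separating G x z} ↔ False) :=
        fun z q hq => ⟨fun h => hq h.1, False.elim⟩
      rw [e _ _ hr, e _ _ hr, e _ _ hr']
      simp
  simple s := by
    ext r
    have h : (r : X ≃ᵢ X) ∈ separating G x ((s : X ≃ᵢ X) x) ↔ (r : X ≃ᵢ X) = s := by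
      rw [s.2.2, Set.mem_singleton_iff]
    exact h.trans ⟨fun h => Subtype.ext h, fun h => congrArg (fun g : G => (g : X ≃ᵢ X)) h⟩
  exists_mem g hg := by
    have hne : (separating G x ((g : X ≃ᵢ X) x)).Nonempty := by
      by_contra hempty
      rw [Set.not_nonempty_iff_eq_empty] at hempty
      apply hg
      apply Subtype.ext
      refine hfree g g.2 fun q hq => ?_
      by_contra hs
      have : q ∈ separating G x ((g : X ≃ᵢ X) x) := ⟨hq, hs⟩
      simp [hempty] at this
    obtain ⟨s, hs, hs'⟩ := exists_simple_mem_separating hX hp hx hfree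
      (apply_mem_offWalls hx g.2) hne
    exact ⟨⟨s, hs⟩, hs'⟩

theorem IsCocompactDiscreteReflectionGroup.isFiniteRankCoxeterGroup (hX : IsGeodesicSpace X)
    (hG : IsCocompactDiscreteReflectionGroup G) : IsFiniteRankCoxeterGroup G := by
  obtain ⟨-, hp, C, ⟨x, hx, rfl⟩, hc, hstab⟩ := hG
  change x ∈ offWalls G at hx
  change IsCompact (closure (connectedComponentIn (offWalls G) x)) at hc
  have hfree : ∀ g ∈ G, (∀ r ∈ reflectionsIn G, SameSide r x (g x)) → g = 1 :=
    fun g hg hs => eq_one_of_sameSide hX hx hstab hg hs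
  obtain ⟨M, ⟨cs⟩⟩ := (inversionCocycle_of_chamber hX hp hx hfree).exists_coxeterSystem
  have : Finite (simpleReflections G x) := finite_simpleReflections hX hp hx hc
  obtain ⟨n, ⟨e⟩⟩ := Finite.exists_equiv_fin (simpleReflections G x)
  exact ⟨Fin n, inferInstance, _, ⟨cs.reindex e⟩⟩

end Chambers

/-! ### The reflection cocycle of a Coxeter system -/

namespace CoxeterSystem

variable {B W : Type*} [Group W] {M : CoxeterMatrix B} (cs : CoxeterSystem M W)

open Classical in
/-- The action of a simple reflection on pairs of a group element and a sign. -/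
noncomputable def signedConj (i : B) : Function.End (W × ZMod 2) := fun p =>
  (cs.simple i * p.1 * cs.simple i, p.2 + if p.1 = cs.simple i then 1 else 0)

-- The sign counts which of the `2 * n` successive letters of the alternating word meet the current
-- conjugate of `p.1`, each condition being pulled back to `p.1` itself.
open Classical in
theorem signedConj_mul_pow (i j : B) (n : ℕ) (p : W × ZMod 2) :
    ((cs.signedConj i * cs.signedConj j) ^ n) p =
      ((cs.simple i * cs.simple j) ^ n * p.1 * ((cs.simple i * cs.simple j) ^ n)⁻¹,
        p.2 + ∑ k ∈ Finset.range (2 * n),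
          if p.1 = ((cs.simple i * cs.simple j) ^ k)⁻¹ * cs.simple j then 1 else 0) := by
  have hinv : ∀ k : ℕ, cs.simple j * (cs.simple i * cs.simple j) ^ k =
      ((cs.simple i * cs.simple j) ^ k)⁻¹ * cs.simple j := by
    intro k
    have h2 : SemiconjBy (cs.simple j) (cs.simple i * cs.simple j)
        (cs.simple j * cs.simple i) := by simp [SemiconjBy, mul_assoc]
    rw [(h2.pow_right k).eq, ← inv_pow, mul_inv_rev, cs.inv_simple, cs.inv_simple]
  induction n with
  | zero => simp; rfl
  | succ n ih =>
    rw [pow_succ']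
    change (cs.signedConj i * cs.signedConj j) (((cs.signedConj i * cs.signedConj j) ^ n) p) = _
    rw [ih]
    change cs.signedConj i (cs.signedConj j _) = _
    generalize ha : cs.simple i * cs.simple j = a at *
    have hb : cs.simple j * cs.simple i = a⁻¹ := by simp [← ha]
    have e1 : (a ^ n * p.1 * (a ^ n)⁻¹ = cs.simple j) ↔ p.1 = (a ^ (2 * n))⁻¹ * cs.simple j := by
      rw [two_mul, pow_add, mul_inv_rev, mul_assoc (a ^ n)⁻¹, ← hinv n]
      constructor
      · intro h; rw [← h]; group
      · intro h; rw [h]; group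
    have e2 : (cs.simple j * (a ^ n * p.1 * (a ^ n)⁻¹) * cs.simple j = cs.simple i) ↔
        p.1 = (a ^ (2 * n + 1))⁻¹ * cs.simple j := by
      have e3 : (a ^ (2 * n + 1))⁻¹ * cs.simple j =
          (a ^ n)⁻¹ * (cs.simple j * cs.simple i * cs.simple j) * a ^ n := by
        rw [hb, mul_assoc, mul_assoc _ (cs.simple j), hinv n]
        rw [show 2 * n + 1 = n + 1 + n by ring, pow_add, pow_succ]
        group
      rw [e3]
      constructor
      · intro h; rw [← h]; simp [mul_assoc]
      · intro h; rw [h]; simp [mul_assoc]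
    unfold signedConj
    simp only [e1, e2]
    refine Prod.ext ?_ ?_
    · simp only
      rw [pow_succ', ← ha]
      simp [mul_assoc]
    · simp only
      rw [show 2 * (n + 1) = 2 * n + 1 + 1 by ring, Finset.sum_range_succ, Finset.sum_range_succ]
      ring

/-- At the exponent `M i j` the conditions for `k` and `M i j + k` coincide, so every contribution
occurs twice and vanishes modulo 2. -/
theorem isLiftable_signedConj : M.IsLiftable cs.signedConj := by
  classical
  intro i j
  funext p
  rw [signedConj_mul_pow, cs.simple_mul_simple_pow, two_mul, Finset.sum_range_add]
  have : ∀ k, (cs.simple i * cs.simple j) ^ (M i j + k) = (cs.simple i * cs.simple j) ^ k := by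
    intro k
    rw [pow_add, cs.simple_mul_simple_pow, one_mul]
  simp only [this]
  rw [CharTwo.add_self_eq_zero]
  simp
  rfl

/-- The homomorphism extending `signedConj`. -/
noncomputable def signedConjHom : W →* Function.End (W × ZMod 2) :=
  cs.lift ⟨cs.signedConj, cs.isLiftable_signedConj⟩

/-- The reflection cocycle. -/
noncomputable def inversionSign (w t : W) : ZMod 2 := (cs.signedConjHom w (t, 0)).2

theorem signedConjHom_apply (w t : W) (ε : ZMod 2) :
    cs.signedConjHom w (t, ε) = (w * t * w⁻¹, ε + cs.inversionSign w t) := by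
  induction w using cs.simple_induction_left generalizing ε with
  | one =>
    rw [inversionSign, map_one]
    change (t, ε) = (1 * t * 1⁻¹, ε + 0)
    simp
  | mul_simple_left w i ih =>
    have h : ∀ ε, cs.signedConjHom (cs.simple i * w) (t, ε) =
        cs.signedConj i (cs.signedConjHom w (t, ε)) := by
      intro ε
      rw [map_mul, signedConjHom, cs.lift_apply_simple]
      rfl
    rw [inversionSign, h, h, ih, ih]
    simp [signedConj, mul_assoc, add_assoc]

theorem inversionSign_mul (v w t : W) : cs.inversionSign (v * w) t =
    cs.inversionSign w t + cs.inversionSign v (w * t * w⁻¹) := by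
  have h : cs.signedConjHom (v * w) (t, 0) = cs.signedConjHom v (cs.signedConjHom w (t, 0)) := by
    rw [map_mul]; rfl
  rw [inversionSign, h, signedConjHom_apply, signedConjHom_apply, zero_add]

theorem inversionSign_one (t : W) : cs.inversionSign 1 t = 0 := by
  rw [inversionSign, map_one]
  rfl

open Classical in
theorem inversionSign_simple (i : B) (t : W) :
    cs.inversionSign (cs.simple i) t = if t = cs.simple i then 1 else 0 := by
  rw [inversionSign, signedConjHom, cs.lift_apply_simple]
  simp [signedConj]

theorem mem_rightInvSeq_of_inversionSign_ne_zero (ω : List B) (t : W)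
    (h : cs.inversionSign (cs.wordProd ω) t ≠ 0) : t ∈ cs.rightInvSeq ω := by
  induction ω with
  | nil => simp [inversionSign_one] at h
  | cons i ω ih =>
    rw [wordProd_cons, inversionSign_mul, inversionSign_simple] at h
    rw [rightInvSeq, List.mem_cons]
    by_cases h0 : cs.inversionSign (cs.wordProd ω) t = 0
    · left
      by_contra hne
      rw [h0, if_neg, add_zero] at h
      · exact h rfl
      · intro hc
        apply hne
        rw [← hc]; group
    · exact Or.inr (ih h0)

/-- For `t = u s u⁻¹` the contributions of `u` and `u⁻¹` cancel, as they do in `u * u⁻¹ = 1`, and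
the middle letter contributes 1. -/
theorem IsReflection.inversionSign_self {cs : CoxeterSystem M W} {t : W}
    (ht : cs.IsReflection t) : cs.inversionSign t t = 1 := by
  obtain ⟨u, i, rfl⟩ := ht
  have h1 : cs.inversionSign (u * u⁻¹) (u * cs.simple i * u⁻¹) = 0 := by
    rw [mul_inv_cancel, inversionSign_one]
  have e : u⁻¹ * (u * cs.simple i * u⁻¹) * u⁻¹⁻¹ = cs.simple i := by group
  rw [inversionSign_mul, e] at h1
  rw [inversionSign_mul, e, inversionSign_mul, inversionSign_simple, if_pos rfl]
  rw [cs.inv_simple, cs.simple_mul_simple_self, one_mul]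
  rw [← add_assoc, add_right_comm, h1, zero_add]

/-- Sign 1 puts `t` in the inversion sequence of a reduced word, so `t` shortens `w`. Multiplying by
`t` flips the sign, so sign 0 means that `t` shortens `w * t`. -/
theorem length_mul_lt_iff {t : W} (ht : cs.IsReflection t) (w : W) :
    cs.length (w * t) < cs.length w ↔ cs.inversionSign w t = 1 := by
  have key : ∀ w, cs.inversionSign w t ≠ 0 → cs.length (w * t) < cs.length w := by
    intro w hw
    obtain ⟨ω, hω, rfl⟩ := cs.exists_isReduced w
    exact (cs.isRightInversion_of_mem_rightInvSeq hω
      (cs.mem_rightInvSeq_of_inversionSign_ne_zero ω t hw)).2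
  have h01 : ∀ x : ZMod 2, x ≠ 0 → x = 1 := by decide
  constructor
  · intro h
    apply h01
    intro h0
    have h1 : cs.inversionSign (w * t) t ≠ 0 := by
      rw [inversionSign_mul, ht.inversionSign_self, mul_inv_cancel_right, h0]
      decide
    have h2 := key _ h1
    rw [mul_assoc, ht.mul_self, mul_one] at h2
    omega
  · intro h
    exact key w (by rw [h]; decide)

/-- An edge of the Cayley graph whose endpoints are on different sides of the wall of a
reflection `t` is exchanged by `t`. -/
theorem conj_eq_simple_of_crossing {t : W} (ht : cs.IsReflection t) {w : W} {i : B}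
    (h1 : cs.length w < cs.length (w * t))
    (h2 : cs.length (cs.simple i * w * t) < cs.length (cs.simple i * w)) :
    w * t * w⁻¹ = cs.simple i := by
  have h01 : ∀ x : ZMod 2, x ≠ 1 → x = 0 := by decide
  have h3 := h01 _ (mt (cs.length_mul_lt_iff ht w).2 (by omega))
  have h4 := (cs.length_mul_lt_iff ht _).1 h2
  rw [inversionSign_mul, h3, inversionSign_simple, zero_add] at h4
  by_contra hne
  rw [if_neg hne] at h4
  exact absurd h4 (by decide)

end CoxeterSystem

/-! ### Concatenation of geodesics -/

section Joined

variable {X : Type v} [MetricSpace X]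

/-- Two points are joined by a geodesic. -/
def GeodesicallyJoined (x y : X) : Prop := ∃ ξ : ℝ → X, IsGeodesic ξ x y

theorem GeodesicallyJoined.refl (x : X) : GeodesicallyJoined x x := by
  refine ⟨fun _ => x, ?_, rfl, rfl⟩
  intro s hs t ht
  rw [dist_self, Set.Icc_self, Set.mem_singleton_iff] at *
  simp [hs, ht]

theorem GeodesicallyJoined.symm {x y : X} (h : GeodesicallyJoined x y) :
    GeodesicallyJoined y x := by
  obtain ⟨ξ, hξ⟩ := h
  refine ⟨fun t => ξ (dist x y - t), ?_, ?_, ?_⟩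
  · intro s hs t ht
    rw [dist_comm y x] at hs ht
    rw [hξ.1 _ ⟨by linarith [hs.2], by linarith [hs.1]⟩ _ ⟨by linarith [ht.2], by linarith [ht.1]⟩,
      abs_sub_comm]
    congr 1; ring
  · simp [hξ.2.2]
  · simp [dist_comm y x, hξ.2.1]

/-- Upper bounds for the concatenated path come from the triangle inequality; since its length
equals `dist x z`, none of them can be strict. -/
theorem GeodesicallyJoined.trans {x y z : X} (h : GeodesicallyJoined x y)
    (h' : GeodesicallyJoined y z) (hd : dist x z = dist x y + dist y z) :
    GeodesicallyJoined x z := by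
  obtain ⟨ξ, hξ⟩ := h
  obtain ⟨η, hη⟩ := h'
  let ζ : ℝ → X := fun t => if t ≤ dist x y then ξ t else η (t - dist x y)
  have hx : ∀ t ∈ Set.Icc 0 (dist x z), dist x (ζ t) ≤ t := by
    intro t ht
    by_cases htd : t ≤ dist x y
    · simp only [ζ, if_pos htd]
      exact (hξ.dist_left ⟨ht.1, htd⟩).le
    · simp only [ζ, if_neg htd]
      have := dist_triangle x y (η (t - dist x y))
      rw [hη.dist_left ⟨by linarith, by linarith [ht.2]⟩] at this
      linarith
  have hz : ∀ t ∈ Set.Icc 0 (dist x z), dist (ζ t) z ≤ dist x z - t := by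
    intro t ht
    by_cases htd : t ≤ dist x y
    · simp only [ζ, if_pos htd]
      have := dist_triangle (ξ t) y z
      rw [hξ.dist_right ⟨ht.1, htd⟩] at this
      linarith
    · simp only [ζ, if_neg htd]
      rw [hη.dist_right ⟨by linarith, by linarith [ht.2]⟩]
      linarith
  have key : ∀ s ∈ Set.Icc 0 (dist x z), ∀ t ∈ Set.Icc 0 (dist x z), s ≤ t →
      dist (ζ s) (ζ t) = t - s := by
    intro s hs t ht hst
    apply le_antisymm
    · by_cases h1 : t ≤ dist x y
      · have h2 : s ≤ dist x y := hst.trans h1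
        simp only [ζ, if_pos h1, if_pos h2]
        rw [hξ.1 s ⟨hs.1, h2⟩ t ⟨ht.1, h1⟩, abs_sub_comm, abs_of_nonneg (by linarith)]
      · by_cases h2 : s ≤ dist x y
        · simp only [ζ, if_neg h1, if_pos h2]
          have := dist_triangle (ξ s) y (η (t - dist x y))
          rw [hξ.dist_right ⟨hs.1, h2⟩, hη.dist_left ⟨by linarith, by linarith [ht.2]⟩] at this
          linarith
        · simp only [ζ, if_neg h1, if_neg h2]
          rw [hη.1 _ ⟨by linarith, by linarith [hs.2]⟩ _ ⟨by linarith, by linarith [ht.2]⟩,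
            abs_sub_comm, abs_of_nonneg (by linarith)]
          linarith
    · have h1 := dist_triangle x (ζ s) z
      have h2 := dist_triangle (ζ s) (ζ t) z
      linarith [hx s hs, hz t ht]
  refine ⟨ζ, ?_, ?_, ?_⟩
  · intro s hs t ht
    rcases le_total s t with hst | hst
    · rw [key s hs t ht hst, abs_sub_comm, abs_of_nonneg (by linarith)]
    · rw [dist_comm, key t ht s hs hst, abs_of_nonneg (by linarith)]
  · simp [ζ, hξ.2.1]
  · have h1 := hz (dist x z) ⟨dist_nonneg, le_rfl⟩
    rw [sub_self] at h1
    exact dist_le_zero.1 h1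

end Joined

/-! ### The geometric realization of a graph -/

/-- The path metric of a connected graph. -/
structure GraphMetric (V : Type*) where
  /-- The combinatorial distance. -/
  d : V → V → ℕ
  self : ∀ x, d x x = 0
  symm : ∀ x y, d x y = d y x
  triangle : ∀ x y z, d x z ≤ d x y + d y z
  eq_of_zero : ∀ x y, d x y = 0 → x = y
  step : ∀ x y n, d x y = n + 1 → ∃ z, d x z = 1 ∧ d z y = n

namespace GraphMetric

variable {V : Type v} (δ : GraphMetric V)

/-- The distances from the point at distance `a` from `u` on the edge from `u` to `v` to the
vertices. -/
noncomputable def edgeFun (u v : V) (a : ℝ) : V → ℝ := fun x => min (a + δ.d u x) (1 - a + δ.d v x)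

/-- The distances from a vertex to the vertices. -/
def vertexFun (v : V) : V → ℝ := fun x => δ.d v x

/-- The geometric realization of a graph with edges of length one. Points are represented by their
distance functions to the vertices. -/
def Realization : Type v := {f : V → ℝ // (∃ v, f = δ.vertexFun v) ∨
  ∃ u v a, δ.d u v = 1 ∧ 0 < a ∧ a < 1 ∧ f = δ.edgeFun u v a}

variable {δ}

instance : CoeFun δ.Realization (fun _ => V → ℝ) := ⟨Subtype.val⟩

theorem tri (x y z : V) : (δ.d x z : ℝ) ≤ δ.d x y + δ.d y z := by
  exact_mod_cast δ.triangle x y z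

theorem edgeFun_swap (u v : V) (a : ℝ) : δ.edgeFun u v a = δ.edgeFun v u (1 - a) := by
  funext x
  simp only [edgeFun]
  rw [min_comm]
  congr 2
  ring

theorem edgeFun_zero {u v : V} (h : δ.d u v = 1) : δ.edgeFun u v 0 = δ.vertexFun u := by
  funext x
  simp only [edgeFun, vertexFun]
  have := tri (δ := δ) u v x
  rw [h] at this
  rw [min_eq_left] <;> push_cast at * <;> linarith

theorem edgeFun_one {u v : V} (h : δ.d u v = 1) : δ.edgeFun u v 1 = δ.vertexFun v := by
  rw [edgeFun_swap, sub_self, edgeFun_zero (by rw [δ.symm, h])]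

theorem edgeFun_left {u v : V} (h : δ.d u v = 1) {a : ℝ} (ha : a ≤ 1) : δ.edgeFun u v a u = a := by
  simp only [edgeFun, δ.self, δ.symm v u, h]
  rw [min_eq_left] <;> push_cast <;> linarith

theorem edgeFun_right {u v : V} (h : δ.d u v = 1) {a : ℝ} (ha : 0 ≤ a) :
    δ.edgeFun u v a v = 1 - a := by
  rw [edgeFun_swap, edgeFun_left (by rw [δ.symm, h]) (by linarith)]

theorem abs_edgeFun_sub (u v : V) (a b : ℝ) (x : V) :
    |δ.edgeFun u v a x - δ.edgeFun u v b x| ≤ |a - b| := by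
  simp only [edgeFun]
  refine (abs_min_sub_min_le_max _ _ _ _).trans (max_le ?_ ?_)
  · apply le_of_eq; congr 1; ring
  · rw [abs_sub_comm a b]; apply le_of_eq; congr 1; ring

/-! ### Metric and geodesics of the realization -/

namespace Realization

theorem apply_le_add (f : δ.Realization) (x y : V) : f x ≤ f y + δ.d x y := by
  obtain ⟨f, ⟨v, rfl⟩ | ⟨u, v, a, huv, ha, ha', rfl⟩⟩ := f
  · have := tri (δ := δ) v y x
    rw [δ.symm y x] at this
    exact this
  · have h1 := tri (δ := δ) v y x
    have h2 := tri (δ := δ) u y x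
    rw [δ.symm y x] at h1 h2
    simp only [edgeFun]
    rw [← min_add_add_right]
    exact min_le_min (by linarith) (by linarith)

theorem le_apply_add (f : δ.Realization) (x y : V) : (δ.d x y : ℝ) ≤ f x + f y := by
  obtain ⟨f, ⟨v, rfl⟩ | ⟨u, v, a, huv, ha, ha', rfl⟩⟩ := f
  · have := tri (δ := δ) x v y
    rw [δ.symm x v] at this
    exact this
  · have h1 := tri (δ := δ) x v y
    have h2 := tri (δ := δ) x u y
    have h3 := tri (δ := δ) u v y
    have h4 := tri (δ := δ) v u y
    rw [δ.symm v u] at h4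
    rw [δ.symm x v] at h1
    rw [δ.symm x u] at h2
    rw [huv] at h3 h4
    push_cast at *
    simp only [edgeFun]
    rcases min_cases (a + (δ.d u x : ℝ)) (1 - a + δ.d v x) with h | h <;>
    rcases min_cases (a + (δ.d u y : ℝ)) (1 - a + δ.d v y) with h' | h' <;>
    linarith

theorem apply_nonneg (f : δ.Realization) (x : V) : 0 ≤ f x := by
  have := f.le_apply_add x x
  rw [δ.self] at this
  push_cast at this
  linarith

/-- The set of endpoints of the open cell containing a point. -/
def cell (f : δ.Realization) : Set V := {x | f x < 1}

theorem nonempty_vertices (f : δ.Realization) : Nonempty V := by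
  obtain ⟨v, -⟩ | ⟨u, -⟩ := f.2
  exacts [⟨v⟩, ⟨u⟩]

open Classical in
noncomputable instance : Dist δ.Realization :=
  -- Within one cell the segment is shortest and its length is the supremum; between different cells
  -- a path passes through a vertex, whence the infimum. The supremum alone would be too small for
  -- opposite edges of a complete graph on four vertices.
  ⟨fun f g => if f.cell = g.cell then ⨆ x, |f x - g x| else ⨅ x, (f x + g x)⟩

/-- The supremum formula never exceeds the infimum formula, so the bounds each one provides hold for
`dist` in both cases. -/
theorem abs_sub_le_add (f g : δ.Realization) (x y : V) : |f x - g x| ≤ f y + g y := by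
  have h1 := f.apply_le_add x y
  have h2 := g.apply_le_add x y
  have h3 := f.le_apply_add x y
  have h4 := g.le_apply_add x y
  rw [abs_le]
  constructor <;> linarith

theorem bddAbove_abs_sub (f g : δ.Realization) :
    BddAbove (Set.range fun x => |f x - g x|) := by
  obtain ⟨y⟩ := f.nonempty_vertices
  refine ⟨f y + g y, ?_⟩
  rintro _ ⟨x, rfl⟩
  exact abs_sub_le_add f g x y

theorem bddBelow_add (f g : δ.Realization) : BddBelow (Set.range fun x => f x + g x) := by
  refine ⟨0, ?_⟩
  rintro _ ⟨x, rfl⟩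
  exact add_nonneg (f.apply_nonneg x) (g.apply_nonneg x)

theorem dist_of_cell_eq {f g : δ.Realization} (h : f.cell = g.cell) :
    dist f g = ⨆ x, |f x - g x| := if_pos h

theorem dist_of_cell_ne {f g : δ.Realization} (h : f.cell ≠ g.cell) :
    dist f g = ⨅ x, (f x + g x) := if_neg h

theorem abs_sub_le_dist (f g : δ.Realization) (x : V) : |f x - g x| ≤ dist f g := by
  have := f.nonempty_vertices
  by_cases h : f.cell = g.cell
  · rw [dist_of_cell_eq h]
    exact le_ciSup (bddAbove_abs_sub f g) x
  · rw [dist_of_cell_ne h]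
    exact le_ciInf fun y => abs_sub_le_add f g x y

theorem dist_le_add (f g : δ.Realization) (x : V) : dist f g ≤ f x + g x := by
  have := f.nonempty_vertices
  by_cases h : f.cell = g.cell
  · rw [dist_of_cell_eq h]
    exact ciSup_le fun y => abs_sub_le_add f g y x
  · rw [dist_of_cell_ne h]
    exact ciInf_le (bddBelow_add f g) x

theorem dist_le_of_cell_eq {f g : δ.Realization} (h : f.cell = g.cell) {c : ℝ}
    (hc : ∀ x, |f x - g x| ≤ c) : dist f g ≤ c := by
  have := f.nonempty_vertices
  rw [dist_of_cell_eq h]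
  exact ciSup_le hc

theorem le_dist_of_cell_ne {f g : δ.Realization} (h : f.cell ≠ g.cell) {c : ℝ}
    (hc : ∀ x, c ≤ f x + g x) : c ≤ dist f g := by
  have := f.nonempty_vertices
  rw [dist_of_cell_ne h]
  exact le_ciInf hc

theorem dist_triangle' (p r q : δ.Realization) : dist p q ≤ dist p r + dist r q := by
  by_cases h1 : p.cell = r.cell
  · by_cases h2 : r.cell = q.cell
    · refine dist_le_of_cell_eq (h1.trans h2) fun x => ?_
      have := abs_sub_le (p x) (r x) (q x)
      linarith [abs_sub_le_dist p r x, abs_sub_le_dist r q x]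
    · have : dist p q - dist p r ≤ dist r q := le_dist_of_cell_ne h2 fun x => by
        have := le_abs_self (p x - r x)
        linarith [abs_sub_le_dist p r x, dist_le_add p q x]
      linarith
  · by_cases h2 : r.cell = q.cell
    · have : dist p q - dist r q ≤ dist p r := le_dist_of_cell_ne h1 fun x => by
        have := neg_abs_le (r x - q x)
        linarith [abs_sub_le_dist r q x, dist_le_add p q x]
      linarith
    · have : dist p q - dist r q ≤ dist p r := le_dist_of_cell_ne h1 fun x => by
        have : dist p q - p x - r x ≤ dist r q := le_dist_of_cell_ne h2 fun y => by
          have := r.le_apply_add x y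
          have h3 := p.apply_le_add y x
          rw [δ.symm y x] at h3
          linarith [dist_le_add p q y]
        linarith
      linarith

/-- `x` is an endpoint of the cell containing `f`. -/
def IsEndpoint (f : δ.Realization) (x : V) : Prop :=
  f.1 = δ.vertexFun x ∨ ∃ y a, δ.d x y = 1 ∧ 0 < a ∧ a < 1 ∧ f.1 = δ.edgeFun x y a

theorem exists_endpoint_pair (f : δ.Realization) : ∃ u v, f.IsEndpoint u ∧ f.IsEndpoint v ∧
    ∀ x, f x = min (f u + δ.d u x) (f v + δ.d v x) := by
  obtain ⟨f, ⟨v, rfl⟩ | ⟨u, v, a, huv, ha, ha', rfl⟩⟩ := f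
  · refine ⟨v, v, Or.inl rfl, Or.inl rfl, fun x => ?_⟩
    simp [vertexFun, δ.self]
  · refine ⟨u, v, Or.inr ⟨v, a, huv, ha, ha', rfl⟩,
      Or.inr ⟨u, 1 - a, by rw [δ.symm, huv], by linarith, by linarith, edgeFun_swap _ _ _⟩,
      fun x => ?_⟩
    simp only
    rw [edgeFun_left huv ha'.le, edgeFun_right huv ha.le]
    rfl

theorem exists_endpoint_apply_eq (f : δ.Realization) (x : V) :
    ∃ u, f.IsEndpoint u ∧ f x = f u + δ.d u x := by
  obtain ⟨u, v, hu, hv, h⟩ := f.exists_endpoint_pair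
  rcases min_choice (f u + δ.d u x) (f v + δ.d v x) with h' | h'
  · exact ⟨u, hu, (h x).trans h'⟩
  · exact ⟨v, hv, (h x).trans h'⟩

/-- A path leaving the cell of `f` does so through an endpoint, so the infimum is attained there. -/
theorem exists_endpoint_dist_eq {f g : δ.Realization} (h : f.cell ≠ g.cell) :
    ∃ u, f.IsEndpoint u ∧ dist f g = f u + g u := by
  obtain ⟨u, v, hu, hv, hf⟩ := f.exists_endpoint_pair
  have key : min (f u + g u) (f v + g v) ≤ dist f g := le_dist_of_cell_ne h fun x => by
    rw [hf x, ← min_add_add_right]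
    refine min_le_min ?_ ?_
    · linarith [g.apply_le_add u x]
    · linarith [g.apply_le_add v x]
  rcases min_choice (f u + g u) (f v + g v) with h' | h'
  · exact ⟨u, hu, le_antisymm (dist_le_add f g u) (h' ▸ key)⟩
  · exact ⟨v, hv, le_antisymm (dist_le_add f g v) (h' ▸ key)⟩

theorem eq_vertexFun_of_apply_eq_zero {f : δ.Realization} {x : V} (h : f x = 0) :
    f.1 = δ.vertexFun x := by
  funext y
  have h1 := f.apply_le_add y x
  have h2 := f.le_apply_add x y
  rw [δ.symm y x] at h1
  simp only [vertexFun]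
  linarith

theorem eq_of_dist_eq_zero' {f g : δ.Realization} (h : dist f g = 0) : f = g := by
  apply Subtype.ext
  by_cases hc : f.cell = g.cell
  · funext x
    have := abs_sub_le_dist f g x
    rw [h] at this
    linarith [abs_nonpos_iff.1 this]
  · obtain ⟨u, -, hu⟩ := exists_endpoint_dist_eq hc
    have h1 := f.apply_nonneg u
    have h2 := g.apply_nonneg u
    rw [eq_vertexFun_of_apply_eq_zero (f := f) (x := u) (by linarith),
      eq_vertexFun_of_apply_eq_zero (f := g) (x := u) (by linarith)]

noncomputable instance : MetricSpace δ.Realization where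
  dist_self f := by
    refine le_antisymm (dist_le_of_cell_eq rfl fun x => by simp) ?_
    obtain ⟨x⟩ := f.nonempty_vertices
    exact (abs_nonneg _).trans (abs_sub_le_dist f f x)
  dist_comm f g := by
    by_cases h : f.cell = g.cell
    · rw [dist_of_cell_eq h, dist_of_cell_eq h.symm]
      simp only [abs_sub_comm]
    · rw [dist_of_cell_ne h, dist_of_cell_ne (Ne.symm h)]
      simp only [add_comm]
  dist_triangle p r q := dist_triangle' p r q
  eq_of_dist_eq_zero := eq_of_dist_eq_zero'

variable (δ) in
/-- The vertices of the realization. -/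
def vertex (v : V) : δ.Realization := ⟨δ.vertexFun v, Or.inl ⟨v, rfl⟩⟩

@[simp]
theorem vertex_apply (v x : V) : vertex δ v x = δ.d v x := rfl

theorem dist_vertex (f : δ.Realization) (x : V) : dist f (vertex δ x) = f x := by
  apply le_antisymm
  · have := dist_le_add f (vertex δ x) x
    simpa [δ.self] using this
  · have := abs_sub_le_dist f (vertex δ x) x
    rw [vertex_apply, δ.self, Nat.cast_zero, sub_zero] at this
    exact (le_abs_self _).trans this

theorem vertex_dist (f : δ.Realization) (x : V) : dist (vertex δ x) f = f x := by
  rw [dist_comm, dist_vertex]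

theorem continuous_apply (x : V) : Continuous fun f : δ.Realization => f x := by
  simp only [← dist_vertex]
  fun_prop

/-- The point at distance `a` from `u` on the edge from `u` to `v`. -/
noncomputable def edgePoint {u v : V} (h : δ.d u v = 1) (a : Set.Icc (0 : ℝ) 1) : δ.Realization :=
  ⟨δ.edgeFun u v a, by
    rcases a.2.1.eq_or_lt with h0 | h0
    · rw [← h0, edgeFun_zero h]; exact Or.inl ⟨u, rfl⟩
    rcases a.2.2.eq_or_lt with h1 | h1
    · rw [h1, edgeFun_one h]; exact Or.inl ⟨v, rfl⟩
    exact Or.inr ⟨u, v, a, h, h0, h1, rfl⟩⟩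

theorem cell_of_eq_edgeFun {f : δ.Realization} {u v : V} {a : ℝ} (ha : 0 < a)
    (ha' : a < 1) (hf : f.1 = δ.edgeFun u v a) : f.cell = {u, v} := by
  ext x
  simp only [cell, Set.mem_ofPred_eq, Set.mem_insert_iff, Set.mem_singleton_iff, hf, edgeFun,
    min_lt_iff]
  have key : ∀ (b : ℝ) (w : V), 0 < b → b < 1 → (b + δ.d w x < 1 ↔ x = w) := by
    intro b w hb hb'
    constructor
    · intro hx
      have h1 : (δ.d w x : ℝ) < 1 := by linarith
      have h2 : δ.d w x = 0 := by
        have : δ.d w x < 1 := by exact_mod_cast h1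
        omega
      exact (δ.eq_of_zero _ _ h2).symm
    · rintro rfl
      rw [δ.self]; push_cast; linarith
  rw [key a u ha ha', key (1 - a) v (by linarith) (by linarith)]

theorem cell_of_eq_vertexFun {f : δ.Realization} {u : V} (hf : f.1 = δ.vertexFun u) :
    f.cell = {u} := by
  ext x
  simp only [cell, Set.mem_ofPred_eq, Set.mem_singleton_iff, hf, vertexFun]
  constructor
  · intro hx
    have : δ.d u x < 1 := by exact_mod_cast hx
    exact (δ.eq_of_zero _ _ (by omega)).symm
  · rintro rfl
    simp [δ.self]

theorem isEndpoint_iff {f : δ.Realization} {x : V} : f.IsEndpoint x ↔ f x < 1 := by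
  constructor
  · rintro (h | ⟨y, a, h, ha, ha', hf⟩)
    · change x ∈ f.cell
      rw [cell_of_eq_vertexFun h]; rfl
    · change x ∈ f.cell
      rw [cell_of_eq_edgeFun ha ha' hf]; exact Or.inl rfl
  · intro hx
    change x ∈ f.cell at hx
    obtain ⟨v, hf⟩ | ⟨u, v, a, huv, ha, ha', hf⟩ := f.2
    · rw [cell_of_eq_vertexFun hf] at hx
      obtain rfl : x = v := hx
      exact Or.inl hf
    · rw [cell_of_eq_edgeFun ha ha' hf] at hx
      rcases hx with rfl | hx
      · exact Or.inr ⟨v, a, huv, ha, ha', hf⟩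
      · obtain rfl : x = v := hx
        exact Or.inr ⟨u, 1 - a, by rw [δ.symm, huv], by linarith, by linarith,
          by rw [← edgeFun_swap]; exact hf⟩

/-- Two points in the same open edge. -/
theorem exists_eq_edgeFun_of_cell_eq {f g : δ.Realization} {u v : V} {a : ℝ} (h : δ.d u v = 1)
    (ha : 0 < a) (ha' : a < 1) (hf : f.1 = δ.edgeFun u v a) (hfg : f.cell = g.cell) :
    ∃ b, 0 < b ∧ b < 1 ∧ g.1 = δ.edgeFun u v b := by
  have hg := hfg.symm.trans (cell_of_eq_edgeFun ha ha' hf)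
  have hne : u ≠ v := by rintro rfl; simp [δ.self] at h
  have hu : g u < 1 := by change u ∈ g.cell; rw [hg]; exact Or.inl rfl
  have hv : v ∈ g.cell := by rw [hg]; exact Or.inr rfl
  rcases isEndpoint_iff.2 hu with h1 | ⟨w, b, hw, hb, hb', h1⟩
  · rw [cell_of_eq_vertexFun h1] at hv
    exact absurd hv.symm hne
  · rw [cell_of_eq_edgeFun hb hb' h1] at hv
    rcases hv with rfl | hv
    · exact absurd rfl hne
    · obtain rfl : v = w := hv
      exact ⟨b, hb, hb', h1⟩

theorem dist_edgePoint {u v : V} (h : δ.d u v = 1) (a b : Set.Icc (0 : ℝ) 1) :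
    dist (edgePoint h a) (edgePoint h b) = |(a : ℝ) - b| := by
  have hl : ∀ c : Set.Icc (0 : ℝ) 1, edgePoint h c u = c := fun c => edgeFun_left h c.2.2
  have hr : ∀ c : Set.Icc (0 : ℝ) 1, edgePoint h c v = 1 - c := fun c => edgeFun_right h c.2.1
  have h0 : ∀ c : Set.Icc (0 : ℝ) 1, (c : ℝ) = 0 → edgePoint h c = vertex δ u := by
    intro c hc
    apply Subtype.ext
    simp only [edgePoint, hc]
    exact edgeFun_zero h
  have h1 : ∀ c : Set.Icc (0 : ℝ) 1, (c : ℝ) = 1 → edgePoint h c = vertex δ v := by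
    intro c hc
    apply Subtype.ext
    simp only [edgePoint, hc]
    exact edgeFun_one h
  rcases a.2.1.eq_or_lt with ha0 | ha0
  · rw [h0 a ha0.symm, vertex_dist, hl, ← ha0, zero_sub, abs_neg, abs_of_nonneg b.2.1]
  rcases a.2.2.eq_or_lt with ha1 | ha1
  · rw [h1 a ha1, vertex_dist, hr, ha1, abs_of_nonneg (by linarith [b.2.2])]
  rcases b.2.1.eq_or_lt with hb0 | hb0
  · rw [h0 b hb0.symm, dist_vertex, hl, ← hb0, sub_zero, abs_of_nonneg a.2.1]
  rcases b.2.2.eq_or_lt with hb1 | hb1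
  · rw [h1 b hb1, dist_vertex, hr, hb1, abs_sub_comm, abs_of_nonneg (by linarith [a.2.2])]
  apply le_antisymm
  · refine dist_le_of_cell_eq ?_ fun x => abs_edgeFun_sub u v a b x
    rw [cell_of_eq_edgeFun ha0 ha1 rfl, cell_of_eq_edgeFun hb0 hb1 rfl]
  · have := abs_sub_le_dist (edgePoint h a) (edgePoint h b) u
    rwa [hl, hl] at this

theorem isometry_edgePoint {u v : V} (h : δ.d u v = 1) : Isometry (edgePoint h) :=
  Isometry.of_dist_eq fun a b => by rw [dist_edgePoint]; rfl

theorem joined_edgePoint {u v : V} (h : δ.d u v = 1) (a b : Set.Icc (0 : ℝ) 1) :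
    GeodesicallyJoined (edgePoint h a) (edgePoint h b) := by
  have key : ∀ a b : Set.Icc (0 : ℝ) 1, (a : ℝ) ≤ b →
      GeodesicallyJoined (edgePoint h a) (edgePoint h b) := by
    intro a b hab
    have hd : dist (edgePoint h a) (edgePoint h b) = b - a := by
      rw [dist_edgePoint, abs_sub_comm, abs_of_nonneg (by linarith)]
    refine ⟨fun t => edgePoint h (Set.projIcc 0 1 zero_le_one (a + t)), ?_, ?_, ?_⟩
    · rw [hd]
      intro s hs t ht
      rw [dist_edgePoint,
        Set.projIcc_of_mem zero_le_one ⟨add_nonneg a.2.1 hs.1, by linarith [hs.2, b.2.2]⟩,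
        Set.projIcc_of_mem zero_le_one ⟨add_nonneg a.2.1 ht.1, by linarith [ht.2, b.2.2]⟩]
      simp
    · simp
    · simp [hd]
  rcases le_total (a : ℝ) b with hab | hab
  · exact key a b hab
  · exact (key b a hab).symm

theorem joined_vertex_of_isEndpoint {f : δ.Realization} {x : V} (h : f.IsEndpoint x) :
    GeodesicallyJoined f (vertex δ x) := by
  rcases h with h | ⟨y, a, h, ha, ha', hf⟩
  · rw [show f = vertex δ x from Subtype.ext h]
    exact GeodesicallyJoined.refl _
  · have h1 : f = edgePoint h ⟨a, ha.le, ha'.le⟩ := Subtype.ext hf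
    have h2 : vertex δ x = edgePoint h ⟨0, le_rfl, zero_le_one⟩ := Subtype.ext (edgeFun_zero h).symm
    rw [h1, h2]
    exact joined_edgePoint h _ _

theorem joined_vertex_vertex (n : ℕ) (x y : V) (h : δ.d x y = n) :
    GeodesicallyJoined (vertex δ x) (vertex δ y) := by
  induction n generalizing x with
  | zero =>
    rw [δ.eq_of_zero _ _ h]
    exact GeodesicallyJoined.refl _
  | succ n ih =>
    obtain ⟨z, hxz, hzy⟩ := δ.step x y n h
    refine GeodesicallyJoined.trans (y := vertex δ z) ?_ (ih z hzy) ?_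
    · have h1 : vertex δ x = edgePoint hxz ⟨0, le_rfl, zero_le_one⟩ :=
        Subtype.ext (edgeFun_zero hxz).symm
      have h2 : vertex δ z = edgePoint hxz ⟨1, zero_le_one, le_rfl⟩ :=
        Subtype.ext (edgeFun_one hxz).symm
      rw [h1, h2]
      exact joined_edgePoint hxz _ _
    · rw [dist_vertex, dist_vertex, dist_vertex, vertex_apply, vertex_apply, vertex_apply, h, hxz,
        hzy]
      push_cast; ring

theorem joined_vertex (f : δ.Realization) (x : V) : GeodesicallyJoined f (vertex δ x) := by
  obtain ⟨u, hu, h⟩ := f.exists_endpoint_apply_eq x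
  refine (joined_vertex_of_isEndpoint hu).trans (joined_vertex_vertex _ u x rfl) ?_
  rw [dist_vertex, dist_vertex, dist_vertex, vertex_apply, h]

variable (δ) in
theorem isGeodesicSpace : IsGeodesicSpace δ.Realization := by
  intro f g
  by_cases h : f.cell = g.cell
  · obtain ⟨v, hf⟩ | ⟨u, v, a, huv, ha, ha', hf⟩ := f.2
    · obtain ⟨w, hg⟩ | ⟨u', w, b, huw, hb, hb', hg⟩ := g.2
      · rw [cell_of_eq_vertexFun hf, cell_of_eq_vertexFun hg, Set.singleton_eq_singleton_iff] at h
        subst h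
        rw [show f = g from Subtype.ext (hf.trans hg.symm)]
        exact GeodesicallyJoined.refl _
      · obtain ⟨c, hc, hc', hfc⟩ := exists_eq_edgeFun_of_cell_eq huw hb hb' hg h.symm
        rw [show f = edgePoint huw ⟨c, hc.le, hc'.le⟩ from Subtype.ext hfc,
          show g = edgePoint huw ⟨b, hb.le, hb'.le⟩ from Subtype.ext hg]
        exact joined_edgePoint _ _ _
    · obtain ⟨c, hc, hc', hgc⟩ := exists_eq_edgeFun_of_cell_eq huv ha ha' hf h
      rw [show f = edgePoint huv ⟨a, ha.le, ha'.le⟩ from Subtype.ext hf,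
        show g = edgePoint huv ⟨c, hc.le, hc'.le⟩ from Subtype.ext hgc]
      exact joined_edgePoint _ _ _
  · obtain ⟨u, hu, hd⟩ := exists_endpoint_dist_eq h
    refine (joined_vertex_of_isEndpoint hu).trans (joined_vertex g u).symm ?_
    rw [hd, dist_vertex, vertex_dist]

/-- The isometry of the realization induced by an automorphism of the graph. -/
noncomputable def mapIso (e : V ≃ V) (he : ∀ x y, δ.d (e x) (e y) = δ.d x y) :
    δ.Realization ≃ᵢ δ.Realization := by
  have hfun : ∀ (e : V ≃ V), (∀ x y, δ.d (e x) (e y) = δ.d x y) → ∀ f : δ.Realization,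
      (∃ v, (fun x => f (e.symm x)) = δ.vertexFun v) ∨
      ∃ u v a, δ.d u v = 1 ∧ 0 < a ∧ a < 1 ∧ (fun x => f (e.symm x)) = δ.edgeFun u v a := by
    intro e he f
    have he' : ∀ x y, δ.d x (e.symm y) = δ.d (e x) y := fun x y => by rw [← he]; simp
    obtain ⟨v, hf⟩ | ⟨u, v, a, huv, ha, ha', hf⟩ := f.2
    · exact Or.inl ⟨e v, by funext x; simp [hf, vertexFun, he']⟩
    · exact Or.inr ⟨e u, e v, a, by rw [he, huv], ha, ha', by funext x; simp [hf, edgeFun, he']⟩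
  have hes : ∀ x y, δ.d (e.symm x) (e.symm y) = δ.d x y := fun x y => by
    rw [← he]; simp
  refine IsometryEquiv.mk ⟨fun f => ⟨fun x => f (e.symm x), hfun e he f⟩,
    fun f => ⟨fun x => f (e x), hfun e.symm hes f⟩, ?_, ?_⟩ ?_
  · intro f
    apply Subtype.ext
    funext x
    simp
  · intro f
    apply Subtype.ext
    funext x
    simp
  · refine Isometry.of_dist_eq fun f g => ?_
    -- The automorphism relabels cells, so both points stay in the same case of the distance, and
    -- the supremum or infimum is merely reindexed.
    have hcell : cell ⟨fun x => f (e.symm x), hfun e he f⟩ =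
        cell ⟨fun x => g (e.symm x), hfun e he g⟩ ↔ f.cell = g.cell :=
      (Set.preimage_injective.2 e.symm.surjective).eq_iff (a := f.cell) (b := g.cell)
    by_cases h : f.cell = g.cell
    · rw [dist_of_cell_eq h]
      refine (dist_of_cell_eq (hcell.2 h)).trans ?_
      exact e.symm.iSup_congr fun x => rfl
    · rw [dist_of_cell_ne h]
      refine (dist_of_cell_ne (mt hcell.1 h)).trans ?_
      exact e.symm.iInf_congr fun x => rfl

theorem mapIso_apply (e : V ≃ V) (he : ∀ x y, δ.d (e x) (e y) = δ.d x y) (f : δ.Realization)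
    (x : V) : mapIso e he f x = f (e.symm x) := rfl

end Realization

end GraphMetric

/-! ### Reflections of the realization of a graph -/

namespace GraphMetric

variable {V : Type v} {δ : GraphMetric V}

/-- An involutive automorphism of a graph without fixed vertices that exchanges the endpoints of
every edge joining its two sides. -/
structure IsGraphReflection (δ : GraphMetric V) (r : V ≃ V) : Prop where
  involutive : ∀ x, r (r x) = x
  isometry : ∀ x y, δ.d (r x) (r y) = δ.d x y
  ne : ∀ u p, δ.d u p ≠ δ.d u (r p)
  crossing : ∀ p u v, δ.d u v = 1 → δ.d u p < δ.d u (r p) → δ.d v (r p) < δ.d v p → v = r u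

/-- The points of the realization closer to `p` than to `r p`. -/
def halfSpace (δ : GraphMetric V) (r : V ≃ V) (p : V) : Set δ.Realization := {f | f p < f (r p)}

namespace IsGraphReflection

open Realization

variable {r : V ≃ V}

theorem d_apply_left (h : IsGraphReflection δ r) (x y : V) : δ.d (r x) y = δ.d x (r y) := by
  rw [← h.isometry x, h.involutive]

theorem symm_apply (h : IsGraphReflection δ r) (x : V) : r.symm x = r x := by
  rw [Equiv.symm_apply_eq, h.involutive]

/-- The isometry of the realization induced by a graph reflection. -/
noncomputable def iso (h : IsGraphReflection δ r) : δ.Realization ≃ᵢ δ.Realization :=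
  mapIso r h.isometry

theorem iso_apply (h : IsGraphReflection δ r) (f : δ.Realization) (x : V) :
    h.iso f x = f (r x) := by
  rw [iso, mapIso_apply, h.symm_apply]

theorem apply_eq_of_mem_wall (h : IsGraphReflection δ r) {f : δ.Realization}
    (hf : f ∈ wall h.iso) (x : V) : f (r x) = f x := by
  rw [← h.iso_apply, show h.iso f = f from hf]

theorem mem_wall_of_eq_edgeFun (h : IsGraphReflection δ r) {f : δ.Realization} {v : V}
    (hf : f.1 = δ.edgeFun v (r v) (1 / 2)) : f ∈ wall h.iso := by
  apply Subtype.ext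
  funext x
  rw [h.iso_apply, hf, edgeFun, edgeFun, h.isometry, ← h.d_apply_left v x, min_comm]
  norm_num

/-- Vertices are excluded by `ne`, and an edge with both ends on one side gives a strict inequality.
On an edge from `u` to `r u`, equality forces the midpoint. -/
theorem exists_eq_edgeFun_of_apply_eq (h : IsGraphReflection δ r) {f : δ.Realization} {p : V}
    (hf : f p = f (r p)) :
    ∃ v, δ.d v (r v) = 1 ∧ δ.d v p < δ.d v (r p) ∧ f.1 = δ.edgeFun v (r v) (1 / 2) := by
  obtain ⟨v, hv⟩ | ⟨u, v, a, huv, ha, ha', hv⟩ := f.2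
  · rw [hv] at hf
    simp only [vertexFun] at hf
    exact absurd (by exact_mod_cast hf) (h.ne v p)
  have key : ∀ u v a, δ.d u v = 1 → a < 1 → f.1 = δ.edgeFun u v a → δ.d u p < δ.d u (r p) →
      δ.d v (r p) < δ.d v p →
      ∃ v, δ.d v (r v) = 1 ∧ δ.d v p < δ.d v (r p) ∧ f.1 = δ.edgeFun v (r v) (1 / 2) := by
    intro u v a huv ha' hv hu hv'
    obtain rfl := h.crossing p u v huv hu hv'
    have h1 : δ.d u (r p) = δ.d u p + 1 := by
      have := δ.triangle (r u) u p
      rw [h.d_apply_left u p, δ.symm (r u) u] at this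
      omega
    refine ⟨u, huv, hu, ?_⟩
    rw [hv] at hf ⊢
    simp only [edgeFun, h.isometry] at hf
    rw [h.d_apply_left, h1] at hf
    push_cast at hf
    have ha2 : a = 1 / 2 := by
      rcases min_cases (a + (δ.d u p : ℝ)) (1 - a + (δ.d u p + 1)) with h2 | h2 <;>
      rcases min_cases (a + ((δ.d u p : ℝ) + 1)) (1 - a + δ.d u p) with h3 | h3 <;>
      linarith
    rw [ha2]
  rcases lt_or_gt_of_ne (h.ne u p) with hu | hu <;> rcases lt_or_gt_of_ne (h.ne v p) with hv' | hv'
  · exfalso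
    rw [hv] at hf
    simp only [edgeFun] at hf
    have h1 : (δ.d u p : ℝ) < δ.d u (r p) := by exact_mod_cast hu
    have h2 : (δ.d v p : ℝ) < δ.d v (r p) := by exact_mod_cast hv'
    exact (min_lt_min (by linarith) (by linarith)).ne hf
  · exact key u v a huv ha' hv hu hv'
  · exact key v u (1 - a) (by rw [δ.symm, huv]) (by linarith) (by rw [← edgeFun_swap, hv]) hv' hu
  · exfalso
    rw [hv] at hf
    simp only [edgeFun] at hf
    have h1 : (δ.d u (r p) : ℝ) < δ.d u p := by exact_mod_cast hu
    have h2 : (δ.d v (r p) : ℝ) < δ.d v p := by exact_mod_cast hv'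
    exact (min_lt_min (by linarith) (by linarith)).ne hf.symm

theorem mem_wall_iff_apply_eq (h : IsGraphReflection δ r) {f : δ.Realization} (p : V) :
    f ∈ wall h.iso ↔ f p = f (r p) := by
  refine ⟨fun hf => (h.apply_eq_of_mem_wall hf p).symm, fun hf => ?_⟩
  obtain ⟨v, -, -, hv⟩ := h.exists_eq_edgeFun_of_apply_eq hf
  exact h.mem_wall_of_eq_edgeFun hv

theorem isOpen_halfSpace (p : V) : IsOpen (halfSpace δ r p) :=
  isOpen_lt (continuous_apply p) (continuous_apply (r p))

theorem vertex_mem_halfSpace {p v : V} :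
    vertex δ v ∈ halfSpace δ r p ↔ δ.d v p < δ.d v (r p) := by
  simp [halfSpace]

theorem vertex_self_mem_halfSpace (h : IsGraphReflection δ r) (p : V) :
    vertex δ p ∈ halfSpace δ r p := by
  rw [vertex_mem_halfSpace, δ.self]
  have := h.ne p p
  rw [δ.self] at this
  omega

/-- A geodesic leaving a half-space meets the wall. -/
theorem exists_mem_wall (h : IsGraphReflection δ r) {p : V} {f g : δ.Realization}
    (hf : f ∈ halfSpace δ r p) {ξ : ℝ → δ.Realization} (hξ : IsGeodesic ξ f g) {t : ℝ}
    (ht : t ∈ Set.Icc 0 (dist f g)) (hξt : ξ t ∉ halfSpace δ r p) :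
    ∃ a ∈ Set.Icc 0 (dist f g), ξ a ∈ wall h.iso := by
  have hc : ContinuousOn (fun s => ξ s p - ξ s (r p)) (Set.Icc 0 t) :=
    ((continuous_apply p).sub (continuous_apply (r p))).comp_continuousOn
      (hξ.continuousOn.mono (Set.Icc_subset_Icc_right ht.2))
  have h0 : (0 : ℝ) ∈ Set.Icc (ξ 0 p - ξ 0 (r p)) (ξ t p - ξ t (r p)) := by
    rw [hξ.2.1]
    have h1 : f p < f (r p) := hf
    have h2 : ¬ ξ t p < ξ t (r p) := hξt
    exact ⟨by linarith, by linarith⟩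
  obtain ⟨a, ha, ha0⟩ := intermediate_value_Icc ht.1 hc h0
  exact ⟨a, ⟨ha.1, ha.2.trans ht.2⟩, (h.mem_wall_iff_apply_eq p).2 (sub_eq_zero.1 ha0)⟩

/-- A geodesic from `f` to `r v` meets the wall; reflecting the rest of it yields a path to `v` of
the same length. -/
theorem apply_le_apply (h : IsGraphReflection δ r) {p v : V} {f : δ.Realization}
    (hf : f ∈ halfSpace δ r p) (hv : δ.d v p < δ.d v (r p)) : f v ≤ f (r v) := by
  obtain ⟨ξ, hξ⟩ := isGeodesicSpace δ f (vertex δ (r v))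
  obtain ⟨a, ha, hw⟩ := h.exists_mem_wall (p := p) hf hξ ⟨dist_nonneg, le_rfl⟩ (by
    rw [hξ.2.2, vertex_mem_halfSpace, h.isometry, h.d_apply_left]
    omega)
  have h1 := hξ.dist_left ha
  have h2 := hξ.dist_right ha
  rw [dist_vertex, dist_vertex, h.apply_eq_of_mem_wall hw] at h2
  have h3 := (abs_sub_le_dist f (ξ a) v)
  have h4 := le_abs_self (f v - ξ a v)
  linarith

theorem isGeodesicallyConvex_halfSpace (h : IsGraphReflection δ r) (p : V) :
    IsGeodesicallyConvex (halfSpace δ r p) := by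
  intro f hf g hg ξ hξ t ht
  by_contra hξt
  obtain ⟨a, ha, hw⟩ := h.exists_mem_wall hf hξ ht hξt
  have h1 := hξ.dist_left ha
  have h2 := hξ.dist_right ha
  generalize ξ a = m at *
  obtain ⟨v, hv1, hvp, hm⟩ := h.exists_eq_edgeFun_of_apply_eq (h.apply_eq_of_mem_wall hw p).symm
  -- If `k` is outside the open edge of `m`, reaching `m` costs at least `k v` plus half an edge;
  -- inside it, `k` lies strictly on the half next to `v`. In every combination `dist f g` is
  -- smaller than the length through `m`.
  have key : ∀ k ∈ halfSpace δ r p,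
      (m.cell = k.cell ∧ k.1 = δ.edgeFun v (r v) (k v) ∧ 1 / 2 - k v ≤ dist k m ∧ k v < 1 / 2) ∨
      1 / 2 + k v ≤ dist k m := by
    intro k hk
    have hle := h.apply_le_apply hk hvp
    by_cases hc : m.cell = k.cell
    · left
      obtain ⟨b, hb, hb', hkb⟩ := exists_eq_edgeFun_of_cell_eq hv1 (by norm_num) (by norm_num) hm hc
      have e1 : k v = b := by rw [hkb, edgeFun_left hv1 hb'.le]
      have e2 : k (r v) = 1 - b := by rw [hkb, edgeFun_right hv1 hb.le]
      have e3 : m v = 1 / 2 := by rw [hm, edgeFun_left hv1 (by norm_num)]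
      refine ⟨hc, by rw [e1]; exact hkb, ?_, ?_⟩
      · have := abs_sub_le_dist k m v
        rw [e3] at this
        linarith [neg_abs_le (k v - 1 / 2)]
      · refine lt_of_le_of_ne (by linarith) ?_
        rw [e1]
        rintro rfl
        have := (h.mem_wall_iff_apply_eq p).1 (h.mem_wall_of_eq_edgeFun hkb)
        exact (show k p < k (r p) from hk).ne this
    · right
      refine le_dist_of_cell_ne (Ne.symm hc) fun x => ?_
      have e1 := k.apply_le_add v x
      have e2 := k.apply_le_add (r v) x
      rw [hm]
      simp only [edgeFun]
      rcases min_cases (1 / 2 + (δ.d v x : ℝ)) (1 - 1 / 2 + δ.d (r v) x) with h3 | h3 <;> linarith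
  have hfg := dist_le_add f g v
  have hd := dist_comm g m
  rcases key f hf with ⟨c1, f1, f2, f3⟩ | f2 <;> rcases key g hg with ⟨c2, g1, g2, g3⟩ | g2
  · have : dist f g ≤ |f v - g v| := dist_le_of_cell_eq (c1.symm.trans c2) fun x => by
      rw [f1, g1, edgeFun_left hv1 (by linarith), edgeFun_left hv1 (by linarith)]
      exact abs_edgeFun_sub _ _ _ _ _
    rcases abs_cases (f v - g v) with h3 | h3 <;> linarith
  all_goals linarith

theorem isPreconnected_halfSpace (p : V) :
    IsPreconnected (halfSpace δ r p) := by
  refine isPreconnected_of_forall (vertex δ p) fun f hf => ?_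
  obtain ⟨ξ, hξ⟩ := isGeodesicSpace δ f (vertex δ p)
  refine ⟨ξ '' Set.Icc 0 (dist f (vertex δ p)), ?_, ⟨_, ⟨dist_nonneg, le_rfl⟩, hξ.2.2⟩,
    ⟨0, ⟨le_rfl, dist_nonneg⟩, hξ.2.1⟩, hξ.isPreconnected_image le_rfl⟩
  rintro _ ⟨t, ht, rfl⟩
  have h1 := hξ.dist_left ht
  have h2 := hξ.dist_right ht
  rw [dist_vertex, dist_vertex] at h2
  have h3 := abs_sub_le_dist f (ξ t) (r p)
  have h4 : f p < f (r p) := hf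
  change ξ t p < ξ t (r p)
  linarith [le_abs_self (f (r p) - ξ t (r p))]

theorem disjoint_halfSpace (h : IsGraphReflection δ r) (p : V) :
    Disjoint (halfSpace δ r p) (halfSpace δ r (r p)) := by
  rw [Set.disjoint_left]
  intro f h1 h2
  change f (r p) < f (r (r p)) at h2
  rw [h.involutive] at h2
  exact lt_asymm (show f p < f (r p) from h1) h2

theorem compl_wall_eq (h : IsGraphReflection δ r) (p : V) :
    (wall h.iso)ᶜ = halfSpace δ r p ∪ halfSpace δ r (r p) := by
  ext f
  rw [Set.mem_compl_iff, h.mem_wall_iff_apply_eq p, ← ne_eq, ne_iff_lt_or_gt]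
  change _ ↔ f p < f (r p) ∨ f (r p) < f (r (r p))
  rw [h.involutive]

theorem connectedComponentIn_eq (h : IsGraphReflection δ r) {p : V} {f : δ.Realization}
    (hf : f ∈ halfSpace δ r p) : connectedComponentIn (wall h.iso)ᶜ f = halfSpace δ r p := by
  have hsub : halfSpace δ r p ⊆ (wall h.iso)ᶜ := by
    rw [h.compl_wall_eq p]
    exact Set.subset_union_left
  apply Set.Subset.antisymm
  · refine isPreconnected_connectedComponentIn.subset_left_of_subset_union (isOpen_halfSpace p)
      (isOpen_halfSpace (r p)) (h.disjoint_halfSpace p) ?_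
      ⟨f, mem_connectedComponentIn (hsub hf), hf⟩
    rw [← h.compl_wall_eq p]
    exact connectedComponentIn_subset _ _
  · exact (isPreconnected_halfSpace p).subset_connectedComponentIn hf hsub

theorem connectedComponentsOf_eq (h : IsGraphReflection δ r) (p : V) :
    connectedComponentsOf (wall h.iso)ᶜ = {halfSpace δ r p, halfSpace δ r (r p)} := by
  ext C
  constructor
  · rintro ⟨f, hf, rfl⟩
    rw [h.compl_wall_eq p] at hf
    rcases hf with hf | hf
    · exact Or.inl (h.connectedComponentIn_eq hf)
    · exact Or.inr (h.connectedComponentIn_eq hf)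
  · have : ∀ p, halfSpace δ r p ∈ connectedComponentsOf (wall h.iso)ᶜ := fun p => by
      have hv := h.vertex_self_mem_halfSpace p
      refine ⟨vertex δ p, ?_, (h.connectedComponentIn_eq hv).symm⟩
      rw [h.compl_wall_eq p]
      exact Or.inl hv
    rintro (rfl | rfl)
    · exact this _
    · exact this _

theorem interior_wall (h : IsGraphReflection δ r) : interior (wall h.iso) = ∅ := by
  rw [Set.eq_empty_iff_forall_notMem]
  intro m hm
  obtain ⟨p⟩ := m.nonempty_vertices
  obtain ⟨v, hv1, -, hmv⟩ := h.exists_eq_edgeFun_of_apply_eq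
    (h.apply_eq_of_mem_wall (interior_subset hm) p).symm
  obtain ⟨ε, hε, hball⟩ := Metric.isOpen_iff.1 isOpen_interior m hm
  let s := min (ε / 2) (1 / 4)
  have hs : 0 < s := by positivity
  have hs1 : s ≤ 1 / 4 := min_le_right _ _
  have hs2 : s ≤ ε / 2 := min_le_left _ _
  -- A nearby point of the same edge at distance less than 1/2 from `v`, whereas every wall point is
  -- an edge midpoint and so at least 1/2 from each vertex.
  let k := edgePoint hv1 ⟨1 / 2 - s, by linarith, by linarith⟩
  have hmk : m = edgePoint hv1 ⟨1 / 2, by norm_num, by norm_num⟩ := Subtype.ext hmv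
  have hk : k ∈ interior (wall h.iso) := by
    apply hball
    rw [Metric.mem_ball, hmk, dist_edgePoint]
    simp only
    rw [abs_sub_comm, abs_of_nonneg] <;> linarith
  obtain ⟨w, -, -, hw⟩ := h.exists_eq_edgeFun_of_apply_eq
    (h.apply_eq_of_mem_wall (interior_subset hk) p).symm
  have h1 : k v = 1 / 2 - s := edgeFun_left hv1 (by linarith)
  have h2 : 1 / 2 ≤ k v := by
    rw [hw]
    exact le_min (by simp) (by norm_num)
  linarith

theorem isReflection [Nonempty V] (h : IsGraphReflection δ r) : IsReflection h.iso := by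
  obtain ⟨p⟩ := ‹Nonempty V›
  refine ⟨fun f => ?_, ?_, ?_, h.interior_wall⟩
  · apply Subtype.ext
    funext x
    rw [h.iso_apply, h.iso_apply, h.involutive]
  · rw [h.connectedComponentsOf_eq p, Set.ncard_pair]
    intro heq
    have h1 := h.vertex_self_mem_halfSpace p
    exact Set.disjoint_left.1 (h.disjoint_halfSpace p) h1 (heq ▸ h1)
  · rw [h.connectedComponentsOf_eq p]
    rintro _ (rfl | rfl)
    · exact h.isGeodesicallyConvex_halfSpace _
    · exact h.isGeodesicallyConvex_halfSpace _

end IsGraphReflection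

end GraphMetric

/-! ### Coxeter groups acting on their Cayley graphs -/

namespace CoxeterSystem

open GraphMetric GraphMetric.Realization

variable {B : Type*} {W : Type v} [Group W] {M : CoxeterMatrix B} (cs : CoxeterSystem M W)

/-- The word metric of a Coxeter system. -/
noncomputable def cayleyMetric : GraphMetric W where
  d x y := cs.length (x⁻¹ * y)
  self x := by simp
  symm x y := by rw [← cs.length_inv]; simp
  triangle x y z := by
    have := cs.length_mul_le (x⁻¹ * y) (y⁻¹ * z)
    rwa [show x⁻¹ * y * (y⁻¹ * z) = x⁻¹ * z by group] at this
  eq_of_zero x y h := inv_mul_eq_one.1 (cs.length_eq_zero_iff.1 h)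
  step x y n h := by
    have hne : x⁻¹ * y ≠ 1 := fun h1 => by simp [h1] at h
    obtain ⟨i, hi⟩ := cs.exists_leftDescent_of_ne_one hne
    rw [cs.isLeftDescent_iff] at hi
    refine ⟨x * cs.simple i, by simp, ?_⟩
    rw [mul_inv_rev, cs.inv_simple, mul_assoc]
    omega

theorem cayleyMetric_d (x y : W) : cs.cayleyMetric.d x y = cs.length (x⁻¹ * y) := rfl

theorem cayleyMetric_mul_left (w x y : W) :
    cs.cayleyMetric.d (w * x) (w * y) = cs.cayleyMetric.d x y := by
  rw [cayleyMetric_d, cayleyMetric_d]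
  congr 1
  group

theorem exists_of_cayleyMetric_eq_one {x y : W} (h : cs.cayleyMetric.d x y = 1) :
    ∃ i, y = x * cs.simple i := by
  obtain ⟨i, hi⟩ := cs.length_eq_one_iff.1 h
  exact ⟨i, by rw [← hi]; group⟩

theorem IsReflection.isGraphReflection {cs : CoxeterSystem M W} {t : W}
    (ht : cs.IsReflection t) : IsGraphReflection cs.cayleyMetric (Equiv.mulLeft t) where
  involutive x := by simp [← mul_assoc, ht.mul_self]
  isometry x y := cs.cayleyMetric_mul_left t x y
  ne u p := by
    have := (ht.conj u⁻¹).length_mul_right_ne (u⁻¹ * p)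
    rw [show u⁻¹ * t * u⁻¹⁻¹ * (u⁻¹ * p) = u⁻¹ * (t * p) by group] at this
    exact this.symm
  crossing p u v huv h1 h2 := by
    obtain ⟨i, rfl⟩ := cs.exists_of_cayleyMetric_eq_one huv
    simp only [cayleyMetric_d, Equiv.coe_mulLeft] at h1 h2
    -- Translating the edge so that `p` plays the role of the identity turns `t` into `p⁻¹ * t * p`
    -- and the two side conditions into length comparisons.
    have h := cs.conj_eq_simple_of_crossing (ht.conj p⁻¹) (w := u⁻¹ * p) (i := i) (by
      rwa [show u⁻¹ * p * (p⁻¹ * t * p⁻¹⁻¹) = u⁻¹ * (t * p) by group]) (by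
      rw [mul_inv_rev, cs.inv_simple] at h2
      rwa [show cs.simple i * (u⁻¹ * p) * (p⁻¹ * t * p⁻¹⁻¹) = cs.simple i * u⁻¹ * (t * p) by group,
        ← mul_assoc (cs.simple i)])
    rw [Equiv.coe_mulLeft, ← h]
    group

/-- The action of a Coxeter group on the realization of its Cayley graph. -/
noncomputable def cayleyAction :
    W →* (cs.cayleyMetric.Realization ≃ᵢ cs.cayleyMetric.Realization) where
  toFun w := mapIso (Equiv.mulLeft w) (cs.cayleyMetric_mul_left w)
  map_one' := by
    ext f
    apply Subtype.ext
    funext x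
    change f (1⁻¹ * x) = f x
    simp
  map_mul' w z := by
    ext f
    apply Subtype.ext
    funext x
    change f ((w * z)⁻¹ * x) = f (z⁻¹ * (w⁻¹ * x))
    rw [mul_inv_rev, mul_assoc]

theorem cayleyAction_apply (w : W) (f : cs.cayleyMetric.Realization) (x : W) :
    cs.cayleyAction w f x = f (w⁻¹ * x) := rfl

theorem cayleyAction_vertex (w v : W) :
    cs.cayleyAction w (vertex _ v) = vertex cs.cayleyMetric (w * v) := by
  apply Subtype.ext
  funext x
  rw [cayleyAction_apply, vertex_apply, vertex_apply, ← cs.cayleyMetric_mul_left w]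
  simp

theorem IsReflection.isReflection_cayleyAction {cs : CoxeterSystem M W} {t : W}
    (ht : cs.IsReflection t) : _root_.IsReflection (cs.cayleyAction t) :=
  ht.isGraphReflection.isReflection

theorem cayleyAction_vertex_one_apply (w : W) :
    dist (cs.cayleyAction w (vertex _ 1)) (vertex cs.cayleyMetric 1) = cs.length w := by
  rw [cayleyAction_vertex, dist_vertex, vertex_apply, cayleyMetric_d]
  simp

theorem injective_cayleyAction : Function.Injective cs.cayleyAction := by
  rw [injective_iff_map_eq_one]
  intro w hw
  have := cs.cayleyAction_vertex_one_apply w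
  rw [hw, IsometryEquiv.coe_one, id, dist_self] at this
  exact cs.length_eq_zero_iff.1 (by exact_mod_cast this.symm)

theorem isReflectionGroup_range : IsReflectionGroup cs.cayleyAction.range := by
  refine ⟨cs.cayleyAction '' Set.range cs.simple, ?_, ?_⟩
  · rintro _ ⟨_, ⟨i, rfl⟩, rfl⟩
    exact (cs.isReflection_simple i).isReflection_cayleyAction
  · rw [← MonoidHom.map_closure, cs.subgroup_closure_range_simple, MonoidHom.range_eq_map]

theorem finite_length_le [Finite B] (n : ℕ) : {w : W | cs.length w ≤ n}.Finite := by
  refine ((List.finite_length_le B n).image cs.wordProd).subset ?_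
  intro w hw
  obtain ⟨ω, hω, rfl⟩ := cs.exists_isReduced w
  exact ⟨ω, hω.eq.symm.le.trans hw, rfl⟩

theorem isProperIsometryGroup_range [Finite B] : IsProperIsometryGroup cs.cayleyAction.range := by
  intro f N _
  -- `f 1` is the distance from `f` to the identity vertex, which `w` moves by `cs.length w`; the
  -- bound comes from going through `f` and its image.
  refine ((cs.finite_length_le ⌈2 * f 1 + N⌉₊).image cs.cayleyAction).subset ?_
  rintro _ ⟨⟨w, rfl⟩, hw⟩
  refine ⟨w, ?_, rfl⟩
  have h1 := cs.cayleyAction_vertex_one_apply w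
  have h2 := dist_triangle4 (cs.cayleyAction w (vertex _ 1)) (cs.cayleyAction w f) f
    (vertex cs.cayleyMetric 1)
  rw [h1, (cs.cayleyAction w).dist_eq, vertex_dist, dist_vertex] at h2
  have h3 := Metric.mem_ball.1 hw
  have h4 := Nat.le_ceil (2 * f 1 + N)
  have h5 : (cs.length w : ℝ) ≤ (⌈2 * f 1 + N⌉₊ : ℝ) := by linarith
  exact_mod_cast h5

theorem finite_cayley_neighbors [Finite B] (x : W) : {y | cs.cayleyMetric.d x y = 1}.Finite := by
  refine (Set.finite_range fun i => x * cs.simple i).subset ?_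
  intro y hy
  obtain ⟨i, rfl⟩ := cs.exists_of_cayleyMetric_eq_one hy
  exact ⟨i, rfl⟩

/-- The action on vertices is free, so no classification of the reflections in the group is needed.
-/
theorem vertex_mem_offWalls (v : W) :
    vertex cs.cayleyMetric v ∈ offWalls cs.cayleyAction.range := by
  rw [mem_offWalls]
  rintro _ ⟨⟨w, rfl⟩, hr⟩ hw
  have h1 : cs.cayleyAction w (vertex _ v) = vertex cs.cayleyMetric v := hw
  rw [cayleyAction_vertex] at h1
  have h2 : dist (vertex cs.cayleyMetric (w * v)) (vertex cs.cayleyMetric v) = 0 := by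
    rw [h1, dist_self]
  rw [dist_vertex, vertex_apply] at h2
  have h3 := cs.cayleyMetric.eq_of_zero _ _ (by exact_mod_cast h2)
  rw [mul_eq_right] at h3
  subst h3
  have : Nonempty cs.cayleyMetric.Realization := ⟨vertex _ v⟩
  rw [map_one] at hr
  exact not_isReflection_one hr

theorem apply_ne_half_of_mem_offWalls {f : cs.cayleyMetric.Realization}
    (hf : f ∈ offWalls cs.cayleyAction.range) (x : W) : f x ≠ 1 / 2 := by
  intro hx
  rcases isEndpoint_iff.2 (show f x < 1 by linarith) with h | ⟨y, a, hxy, ha, ha', h⟩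
  · rw [h] at hx
    simp only [vertexFun, cs.cayleyMetric.self] at hx
    norm_num at hx
  · rw [h, edgeFun_left hxy ha'.le] at hx
    subst hx
    obtain ⟨i, rfl⟩ := cs.exists_of_cayleyMetric_eq_one hxy
    have ht : cs.IsReflection (x * cs.simple i * x⁻¹) := ⟨x, i, rfl⟩
    refine mem_offWalls.1 hf (cs.cayleyAction (x * cs.simple i * x⁻¹))
      ⟨⟨_, rfl⟩, ht.isReflection_cayleyAction⟩ ?_
    refine ht.isGraphReflection.mem_wall_of_eq_edgeFun (v := x) ?_
    rw [h, Equiv.coe_mulLeft]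
    simp only [inv_mul_cancel_right]

/-- The distance to `x` is continuous and avoids 1/2 off the walls, since a point at distance 1/2
from a vertex is the midpoint of an edge. -/
theorem chamber_subset (x : W) :
    connectedComponentIn (offWalls cs.cayleyAction.range) (vertex cs.cayleyMetric x) ⊆
      {f | f x < 1 / 2} := by
  have h : connectedComponentIn (offWalls cs.cayleyAction.range) (vertex cs.cayleyMetric x) ⊆
      {f | f x < 1 / 2} ∪ {f | 1 / 2 < f x} := fun f hf =>
    lt_or_gt_of_ne (cs.apply_ne_half_of_mem_offWalls (connectedComponentIn_subset _ _ hf) x)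
  refine isPreconnected_connectedComponentIn.subset_left_of_subset_union
    (isOpen_lt (continuous_apply x) continuous_const)
    (isOpen_lt continuous_const (continuous_apply x)) ?_ h
    ⟨vertex _ x, mem_connectedComponentIn (cs.vertex_mem_offWalls x), ?_⟩
  · rw [Set.disjoint_left]
    intro f h1 h2
    exact lt_asymm (show f x < 1 / 2 from h1) h2
  · change vertex cs.cayleyMetric x x < 1 / 2
    rw [vertex_apply, cs.cayleyMetric.self]
    norm_num

theorem isCompact_closedStar [Finite B] (x : W) :
    IsCompact {f : cs.cayleyMetric.Realization | f x ≤ 1 / 2} := by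
  have hfin : Finite {y | cs.cayleyMetric.d x y = 1} := cs.finite_cayley_neighbors x
  have h1 : IsCompact ({vertex cs.cayleyMetric x} ∪
      ⋃ y : {y | cs.cayleyMetric.d x y = 1}, Set.range (edgePoint y.2)) :=
    isCompact_singleton.union (isCompact_iUnion fun y =>
      isCompact_range (isometry_edgePoint y.2).continuous)
  refine h1.of_isClosed_subset (isClosed_le (continuous_apply x) continuous_const) ?_
  intro f hf
  have hf' : f x ≤ 1 / 2 := hf
  rcases isEndpoint_iff.2 (show f x < 1 by linarith) with h | ⟨y, a, hxy, ha, ha', h⟩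
  · exact Or.inl (Subtype.ext h)
  · exact Or.inr (Set.mem_iUnion.2 ⟨⟨y, hxy⟩, ⟨a, ha.le, ha'.le⟩, Subtype.ext h.symm⟩)

theorem isCocompactDiscreteReflectionGroup_range [Finite B] :
    IsCocompactDiscreteReflectionGroup cs.cayleyAction.range := by
  refine ⟨cs.isReflectionGroup_range, cs.isProperIsometryGroup_range,
    connectedComponentIn (offWalls cs.cayleyAction.range) (vertex cs.cayleyMetric 1),
    ⟨_, cs.vertex_mem_offWalls 1, rfl⟩, ?_, ?_⟩
  · refine (cs.isCompact_closedStar 1).of_isClosed_subset isClosed_closure ?_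
    refine closure_minimal ?_ (isClosed_le (continuous_apply 1) continuous_const)
    exact fun f hf => (show f 1 < 1 / 2 from cs.chamber_subset 1 hf).le
  · ext g
    rw [Set.mem_singleton_iff]
    constructor
    · rintro ⟨⟨w, rfl⟩, hC⟩
      have h1 : cs.cayleyAction w (vertex _ 1) ∈ connectedComponentIn
          (offWalls cs.cayleyAction.range) (vertex cs.cayleyMetric 1) := by
        rw [hC]
        exact ⟨_, mem_connectedComponentIn (cs.vertex_mem_offWalls 1), rfl⟩
      have h2 : cs.cayleyAction w (vertex _ 1) 1 < 1 / 2 := cs.chamber_subset 1 h1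
      rw [← dist_vertex, cayleyAction_vertex_one_apply] at h2
      have h3 : (cs.length w : ℝ) < 1 := by linarith
      have h4 : cs.length w < 1 := by exact_mod_cast h3
      rw [cs.length_eq_zero_iff.1 (Nat.lt_one_iff.1 h4), map_one]
    · rintro rfl
      exact ⟨one_mem _, by simp⟩

end CoxeterSystem

theorem mainTheorem1 (Γ : Type u) [Group Γ] :
    (∃ (X : Type v) (_ : MetricSpace X), IsGeodesicSpace X ∧
      ∃ G : Subgroup (X ≃ᵢ X), IsCocompactDiscreteReflectionGroup G ∧ Nonempty (Γ ≃* G)) ↔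
    IsFiniteRankCoxeterGroup Γ := by
  constructor
  · rintro ⟨X, _, hX, G, hG, ⟨e⟩⟩
    obtain ⟨B, hB, M, ⟨cs⟩⟩ := hG.isFiniteRankCoxeterGroup hX
    exact ⟨B, hB, M, ⟨cs.map e.symm⟩⟩
  · rintro ⟨B, hB, M, ⟨cs⟩⟩
    -- The presented group lives in the lowest universe, so lifting it places the realization in
    -- universe `v`, whatever the universe of `Γ`.
    let cs' : CoxeterSystem M (ULift.{v} M.Group) := M.toCoxeterSystem.map MulEquiv.ulift.symm
    refine ⟨cs'.cayleyMetric.Realization, inferInstance,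
      GraphMetric.Realization.isGeodesicSpace _, cs'.cayleyAction.range,
      cs'.isCocompactDiscreteReflectionGroup_range, ⟨?_⟩⟩
    exact (cs.mulEquiv.trans MulEquiv.ulift.symm).trans
      (MonoidHom.ofInjective cs'.injective_cayleyAction)
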